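/- Let $n\ge 1$, let $\mathbb{Z}_n^2=(\mathbb{Z}/n\mathbb{Z})^2$ be the discrete torus with its $\ell^2$-distance $d$, and let $S=(S_i)_{i\ge 0}$ be the discrete-time simple random walk on $\mathbb{Z}_n^2$, with law $P_x$ and expectation $E_x$ when started at $x$, and $P_\mu,E_\mu$ when started from a probability distribution $\mu$. Put $H_A=\min\{i\ge 0: S_i\in A\}$ and $B(y,r)=\{z: d(y,z)<r\}$; let $\partial A=\{z\notin A: d(z,w)=1\text{ for some }w\in A\}$ if $|A|\ge 2$, and $\partial\{z\}=\{z\}$. For $0<r<R<n/2$ and $k\ge 1$ define $$R_1(y,R,r)=H_{\partial B(y,r)},\qquad D_k(y,R,r)=\min\{i>R_k(y,R,r): S_i\in\partial B(y,R)\},$$ $$R_{k+1}(y,R,r)=\min\{i>D_k(y,R,r): S_i\in\partial B(y,r)\}.$$ Let $\mu_r^{y,R}$ and $\mu_R^{y,r}$ be probability measures on $\partial B(y,R)$ and on $\partial B(y,r)$, respectively, such that $$\mu_r^{y,R}(z)=P_{\mu_R^{y,r}}[S_{H_{\partial B(y,R)}}=z]\ \ (z\in\partial B(y,R)),\qquad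 \mu_R^{y,r}(z)=P_{\mu_r^{y,R}}[S_{H_{\partial B(y,r)}}=z]\ \ (z\in\partial B(y,r)),$$ and set $$q(y,R,r)=\min_{u\in\partial B(y,R),\ v\in\partial B(y,r)}\frac{P_v[S_{H_{\partial B(y,R)}}=u]}{\mu_r^{y,R}(u)}.$$ There exist constants $c_1,\dots,c_8\in(0,\infty)$ such that for all $n\in\mathbb{N}$, $n\ge1$, all $y\in\mathbb{Z}_n^2$ and all real $r,R$ with $c_1\le r<R/4<n/8$, a pair $(\mu_r^{y,R},\mu_R^{y,r})$ as above exists, and for every such pair $q(y,R,r)>0$, the expectations $E_{\mu_r^{y,R}}[D_1(y,R,r)]$ and $E_{\mu_r^{y,R}}[H_{\partial B(y,r)}]$ are finite, and for all $x\in\mathbb{Z}_n^2$, all integers $m\ge 1+4\,q(y,R,r)^{-1}$ and all $\delta\in\left(\frac{4}{(m-1)q(y,R,r)},1\right)$, $$P_x\left[\left|\frac{D_m(y,R,r)}{E_{\mu_r^{y,R}}[D_1(y,R,r)]\,(m-1)}-1\right|\ge\delta\right]\le c_2\exp\left\{-c_3\,\delta\,\frac{E_{\mu_r^{y,R}}[D_1(y,R,r)]}{n^2\log(n/r)}(m-1)\right\}$$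 $$+\,c_4\exp\left\{-c_5\,\delta^2(m-1)+c_6\,\delta\,\frac1R(m-1)\right\}+\,c_7\exp\left\{-c_8\,q(y,R,r)\,\delta^2\left(\frac{E_{\mu_r^{y,R}}[H_{\partial B(y,r)}]}{n^2\log(n/r)}\right)^2(m-1)\right\}.$$ -/

import Mathlib

open MeasureTheory ProbabilityTheory
open scoped ENNReal

namespace TorusWalk

noncomputable section

/-- The discrete torus `(ℤ/nℤ)²`. -/
abbrev Torus (n : ℕ) : Type := ZMod n × ZMod n

variable {n : ℕ}

/-- The `ℓ²`-distance on the torus; `ZMod.valMinAbs a` is the representative of `a` of least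
absolute value. -/
def dist2 (x y : Torus n) : ℝ :=
  Real.sqrt (((x.1 - y.1).valMinAbs : ℝ) ^ 2 + ((x.2 - y.2).valMinAbs : ℝ) ^ 2)

/-- The ball `B(x, r) = {y : d(x, y) < r}`. -/
def ball (x : Torus n) (r : ℝ) : Set (Torus n) := {y | dist2 x y < r}

/-- The outer boundary of `A` (for a set with at least two points), with the convention
`∂{x} = {x}`. -/
def bdry (A : Set (Torus n)) : Set (Torus n) :=
  {y | A = {y} ∨ (A.Nontrivial ∧ y ∉ A ∧ ∃ x ∈ A, dist2 x y = 1)}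

/-- The circle `∂B(y, r)`. -/
def circle (y : Torus n) (r : ℝ) : Set (Torus n) := bdry (ball y r)

/-- The four unit steps of the walk. -/
def unitStep (n : ℕ) : Fin 4 → Torus n := ![(1, 0), (-1, 0), (0, 1), (0, -1)]

/-- The law of an i.i.d. sequence of directions, each uniform among the four. -/
def stepLaw : Measure (ℕ → Fin 4) :=
  Measure.infinitePi fun _ : ℕ => (PMF.uniformOfFintype (Fin 4)).toMeasure

/-- The trajectory `(S_k)_{k ≥ 0}` of the walk started at `x` with directions `ω`. -/
def walk (x : Torus n) (ω : ℕ → Fin 4) (k : ℕ) : Torus n :=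
  x + ∑ i ∈ Finset.range k, unitStep n (ω i)

/-- `P_x[S ∈ E]` for the simple random walk `S` and a set `E` of trajectories. -/
def prob (x : Torus n) (E : Set (ℕ → Torus n)) : ℝ≥0∞ := stepLaw {ω | walk x ω ∈ E}

/-- `P_μ[S ∈ E]`, the walk starting from the distribution `μ`. -/
def probFrom [NeZero n] (μ : PMF (Torus n)) (E : Set (ℕ → Torus n)) : ℝ≥0∞ :=
  ∑ x, μ x * prob x E

/-- `E_μ[T(S)]` for a random time `T` with values in `{0, 1, 2, …} ∪ {∞}`, the walk starting
from the distribution `μ`. -/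
def expectFrom [NeZero n] (μ : PMF (Torus n)) (T : (ℕ → Torus n) → ℕ∞) : ℝ≥0∞ :=
  ∑ x, μ x * ∫⁻ ω, (T (walk x ω) : ℝ≥0∞) ∂stepLaw

/-- The hitting time `H_A = min {i ≥ 0 : S_i ∈ A}` (`∞` if there is no such `i`). -/
def hit (A : Set (Torus n)) (s : ℕ → Torus n) : ℕ∞ :=
  ⨅ (i : ℕ) (_ : s i ∈ A), (i : ℕ∞)

/-- `min {i > t : S_i ∈ A}` (`∞` if there is no such `i`). -/
def hitAfter (A : Set (Torus n)) (t : ℕ∞) (s : ℕ → Torus n) : ℕ∞ :=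
  ⨅ (i : ℕ) (_ : t < (i : ℕ∞) ∧ s i ∈ A), (i : ℕ∞)

/-- The event `S_{H_A} = z` (in particular `H_A < ∞`). -/
def hitAt (A : Set (Torus n)) (z : Torus n) : Set (ℕ → Torus n) :=
  {s | ∃ k : ℕ, hit A s = (k : ℕ∞) ∧ s k = z}

/-- The start `R_k(y, R, r)` of the `k`-th excursion from `∂B(y, r)` to `∂B(y, R)`, for `k ≥ 1`.
The value at `k = 0` is a placeholder on which the others do not depend. -/
def excStart (y : Torus n) (R r : ℝ) : ℕ → (ℕ → Torus n) → ℕ∞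
  | 0, _ => 0
  | 1, s => hit (circle y r) s
  | k + 2, s =>
      hitAfter (circle y r) (hitAfter (circle y R) (excStart y R r (k + 1) s) s) s

/-- The end `D_k(y, R, r)` of the `k`-th excursion from `∂B(y, r)` to `∂B(y, R)`, for `k ≥ 1`. -/
def excEnd (y : Torus n) (R r : ℝ) (k : ℕ) (s : ℕ → Torus n) : ℕ∞ :=
  hitAfter (circle y R) (excStart y R r k s) s

/-- `μout` and `μin` are probability measures on `∂B(y, R)` and on `∂B(y, r)`, each of which is
the law of the point at which the walk started from the other one hits its circle. -/
structure IsExcursionPair [NeZero n] (y : Torus n) (R r : ℝ) (μout μin : PMF (Torus n)) :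
    Prop where
  supp_out : ∀ z, z ∉ circle y R → μout z = 0
  supp_in : ∀ z, z ∉ circle y r → μin z = 0
  out_eq : ∀ z ∈ circle y R, μout z = probFrom μin (hitAt (circle y R) z)
  in_eq : ∀ z ∈ circle y r, μin z = probFrom μout (hitAt (circle y r) z)

/-- `q(y, R, r)`, the minimum over `u ∈ ∂B(y, R)` and `v ∈ ∂B(y, r)` of
`P_v[S_{H_{∂B(y, R)}} = u] / μout(u)`. -/
def excQ (y : Torus n) (R r : ℝ) (μout : PMF (Torus n)) : ℝ :=
  ⨅ p : circle y R × circle y r,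
    (prob (p.2 : Torus n) (hitAt (circle y R) (p.1 : Torus n))).toReal
      / (μout (p.1 : Torus n)).toReal

/-- The event `|D_m(y, R, r) / (M (m - 1)) - 1| ≥ δ`; the event `D_m = ∞` is included. -/
def deviation (y : Torus n) (R r M : ℝ) (m : ℕ) (δ : ℝ) : Set (ℕ → Torus n) :=
  {s | excEnd y R r m s = ⊤ ∨
    δ ≤ |((excEnd y R r m s).toNat : ℝ) / (M * ((m : ℝ) - 1)) - 1|}

end

end TorusWalk

/-! The third term on the right already dominates the probability; the first two terms only add
nonnegative quantities.

Let a cycle be a visit to ∂B(y,r) followed by a visit to ∂B(y,R). As the circles are disjoint, D_1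
is one cycle and D_{k+1} is D_k followed by a fresh cycle, so the points S_{D_k} form a Markov chain
with kernel K. The outer measure μout of any excursion pair is stationary for K, M = E_μout[D_1] is
the stationary mean length of a cycle, and the definition of q gives the Doeblin bound K(x,·) ≥ q
μout for every x. Hence Poisson's equation g(x) = (E_x[cycle] − M) + (Kg)(x) has a solution with |g|
≤ 6Λ/q (`exists_poisson`), and D_k − (k−1)M + g(S_{D_k}) is a martingale. In the exponential form
exp(l(D_k − (k−1)M))(1 + l g(S_{D_k})) the first-order terms cancel, and the mean grows by a factor
of at most exp(8000 l²Λ·6Λ/q) per cycle (`stoppedExp_tilted_le`, iterated in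
`stoppedExp_excEnd_le`). Chernoff's bound for ±l with the optimal l gives
exp(−qδ²(M/Λ)²(m−1)/192000), and M is at least the mean hitting time of the inner circle.

What remains is a uniform exponential moment E_x[exp(cycle/(2Λ))] ≤ 4 with Λ = 50 n² log(n/r). If 0
≤ f ≤ Λ and the mean of f drops by at least 1 per step off A, then E_x[exp(H_A/(2Λ))] ≤ 2
(`hasExpBound_hit`). For a circle such an f is explicit: the logarithm of 2 − cos a − cos b in the
angular coordinates a, b of the torus, slightly corrected so that its drift is uniformly negative
(`logPot_drift`). Its singularity is placed at y to treat the outside of the circle and at the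
antipode of y to treat the inside (`hasExpBound_hit_circle`). -/

namespace TorusWalk

noncomputable section

variable {n : ℕ}

/-! ### The law of the walk and the Markov property at a fixed time. -/

/-- Prepend a term to a sequence. -/
def scons {α : Type*} (a : α) (s : ℕ → α) : ℕ → α
  | 0 => a
  | k + 1 => s k

@[simp] lemma scons_zero {α : Type*} (a : α) (s : ℕ → α) : scons a s 0 = a := rfl

@[simp] lemma scons_succ {α : Type*} (a : α) (s : ℕ → α) (k : ℕ) :
    scons a s (k + 1) = s k := rfl

instance : IsProbabilityMeasure stepLaw := by unfold stepLaw; infer_instance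

lemma measurable_uncurry_scons :
    Measurable (fun p : Fin 4 × (ℕ → Fin 4) => scons p.1 p.2) := by
  refine measurable_pi_lambda _ fun k => ?_
  cases k with
  | zero => exact measurable_fst
  | succ k => exact (measurable_pi_apply k).comp measurable_snd

/-- A product measure is determined by its cylinders, and the mass of a cylinder splits off the
factor of time 0. All the Markov properties below rest on this identity. -/
lemma map_scons_stepLaw :
    ((PMF.uniformOfFintype (Fin 4)).toMeasure.prod stepLaw).map
      (fun p : Fin 4 × (ℕ → Fin 4) => scons p.1 p.2) = stepLaw := by
  unfold stepLaw
  refine Measure.eq_infinitePi _ fun s t ht => ?_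
  obtain ⟨N, hN⟩ : ∃ N, s ⊆ Finset.range (N + 1) :=
    ⟨s.sup id, fun i hi => Finset.mem_range.2 (Nat.lt_succ_of_le (Finset.le_sup (f := id) hi))⟩
  -- Full sides pad the index set to an initial segment, so that removing time 0 leaves an initial
  -- segment again.
  set t' : ℕ → Set (Fin 4) := fun i => if i ∈ s then t i else Set.univ with ht'
  have ht'm : ∀ i, MeasurableSet (t' i) := fun i => MeasurableSet.of_discrete
  have hpi : (s : Set ℕ).pi t = (Finset.range (N + 1) : Set ℕ).pi t' := by
    ext ω
    simp only [Set.mem_pi, Finset.mem_coe]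
    constructor
    · intro h i _
      by_cases hi : i ∈ s <;> simp [ht', hi, h]
    · intro h i hi
      simpa [ht', hi] using h i (hN hi)
  have hprod : ∏ i ∈ s, (PMF.uniformOfFintype (Fin 4)).toMeasure (t i)
      = ∏ i ∈ Finset.range (N + 1), (PMF.uniformOfFintype (Fin 4)).toMeasure (t' i) := by
    rw [← Finset.prod_subset hN]
    · refine Finset.prod_congr rfl fun i hi => ?_
      simp [ht', hi]
    · intro i _ hi
      simp [ht', hi]
  rw [hpi, hprod, Measure.map_apply measurable_uncurry_scons
    (MeasurableSet.pi (Finset.countable_toSet _) fun i _ => ht'm i)]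
  have hpre : (fun p : Fin 4 × (ℕ → Fin 4) => scons p.1 p.2) ⁻¹'
      (Finset.range (N + 1) : Set ℕ).pi t'
      = t' 0 ×ˢ (Finset.range N : Set ℕ).pi (fun i => t' (i + 1)) := by
    ext ⟨j, ω⟩
    simp only [Set.mem_preimage, Set.mem_pi, Finset.mem_coe, Finset.mem_range, Set.mem_prod]
    constructor
    · intro h
      exact ⟨h 0 (by omega), fun i hi => h (i + 1) (by omega)⟩
    · rintro ⟨h0, h⟩ i hi
      cases i with
      | zero => exact h0
      | succ i => exact h i (by omega)
  rw [hpre, Measure.prod_prod, Measure.infinitePi_pi _ (fun i _ => ht'm _),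
    Finset.prod_range_succ', mul_comm]

lemma lintegral_stepLaw {Φ : (ℕ → Fin 4) → ℝ≥0∞} (hΦ : Measurable Φ) :
    ∫⁻ ω, Φ ω ∂stepLaw = ∑ j : Fin 4, (4 : ℝ≥0∞)⁻¹ * ∫⁻ ω, Φ (scons j ω) ∂stepLaw := by
  conv_lhs => rw [← map_scons_stepLaw]
  rw [lintegral_map hΦ measurable_uncurry_scons,
    lintegral_prod (fun p : Fin 4 × (ℕ → Fin 4) => Φ (scons p.1 p.2))
      (hΦ.comp measurable_uncurry_scons).aemeasurable, lintegral_fintype]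
  refine Finset.sum_congr rfl fun j _ => ?_
  rw [PMF.toMeasure_apply_singleton _ _ (MeasurableSet.singleton j), mul_comm]
  simp

lemma walk_scons (x : Torus n) (j : Fin 4) (ω : ℕ → Fin 4) :
    walk x (scons j ω) = scons x (walk (x + unitStep n j) ω) := by
  funext k
  cases k with
  | zero => simp [walk]
  | succ k => simp [walk, Finset.sum_range_succ', add_assoc, add_comm (unitStep n j)]

@[simp] lemma walk_zero (x : Torus n) (ω : ℕ → Fin 4) : walk x ω 0 = x := by simp [walk]

/-- The path from time `k` on. -/
def shift {α : Type*} (k : ℕ) (s : ℕ → α) : ℕ → α := fun i => s (k + i)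

@[simp] lemma shift_apply {α : Type*} (k : ℕ) (s : ℕ → α) (i : ℕ) : shift k s i = s (k + i) := rfl

lemma shift_succ_scons {α : Type*} (a : α) (s : ℕ → α) (k : ℕ) :
    shift (k + 1) (scons a s) = shift k s := by
  funext i
  simp [shift, show k + 1 + i = k + i + 1 by omega]

@[simp] lemma shift_zero {α : Type*} (s : ℕ → α) : shift 0 s = s := by
  funext i; simp [shift]

/-- `Φ` depends only on the terms of the path up to time `k`. -/
def DependsUpTo {α β : Type*} (k : ℕ) (Φ : (ℕ → α) → β) : Prop :=
  ∀ s s' : ℕ → α, (∀ i ≤ k, s i = s' i) → Φ s = Φ s'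

/-- The function factors through the first `k` directions, a finite discrete space. -/
lemma DependsUpTo.measurable {β : Type*} [MeasurableSpace β] {k : ℕ} {Φ : (ℕ → Torus n) → β}
    (hΦ : DependsUpTo k Φ) (x : Torus n) : Measurable fun ω => Φ (walk x ω) := by
  let ext : (Finset.range k → Fin 4) → ℕ → Fin 4 :=
    fun p i => if h : i ∈ Finset.range k then p ⟨i, h⟩ else 0
  have h : (fun ω => Φ (walk x ω))
      = (fun p => Φ (walk x (ext p))) ∘ (Finset.range k).restrict := by
    funext ω
    refine hΦ _ _ fun i hi => ?_
    simp only [walk]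
    congr 1
    refine Finset.sum_congr rfl fun l hl => ?_
    have hlk : l < k := (Finset.mem_range.1 hl).trans_le hi
    simp [ext, hlk]
  rw [h]
  exact (measurable_of_finite _).comp (Finset.measurable_restrict _)

lemma lintegral_walk {Φ : (ℕ → Torus n) → ℝ≥0∞} (hΦ : ∀ x, Measurable fun ω => Φ (walk x ω))
    (x : Torus n) :
    ∫⁻ ω, Φ (walk x ω) ∂stepLaw
      = ∑ j : Fin 4, (4 : ℝ≥0∞)⁻¹ * ∫⁻ ω, Φ (scons x (walk (x + unitStep n j) ω)) ∂stepLaw := by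
  rw [lintegral_stepLaw (hΦ x)]
  simp_rw [walk_scons]

/-- The Markov property at time `k`. -/
lemma lintegral_mul_shift [NeZero n] {Φ : (ℕ → Torus n) → ℝ≥0∞}
    (hΦ : ∀ x, Measurable fun ω => Φ (walk x ω)) (k : ℕ) :
    ∀ {Ψ : (ℕ → Torus n) → ℝ≥0∞}, DependsUpTo k Ψ → ∀ x : Torus n,
    ∫⁻ ω, Ψ (walk x ω) * Φ (shift k (walk x ω)) ∂stepLaw
      = ∫⁻ ω, Ψ (walk x ω) * ∫⁻ ω', Φ (walk (walk x ω k) ω') ∂stepLaw ∂stepLaw := by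
  induction k with
  | zero =>
    intro Ψ hΨ x
    have h : ∀ ω, Ψ (walk x ω) = Ψ (fun _ => x) := fun ω => hΨ _ _ fun i hi => by
      obtain rfl : i = 0 := by omega
      simp
    simp [h, lintegral_const_mul _ (hΦ x)]
  | succ k ih =>
    intro Ψ hΨ x
    have hcons : ∀ ω j, Φ (shift (k + 1) (walk x (scons j ω)))
        = Φ (shift k (walk (x + unitStep n j) ω)) := by
      intro ω j
      rw [walk_scons, shift_succ_scons]
    -- The shifted path is a function of the position at time `k + 1` and of the later directions;
    -- positions are countable, so measurability for each fixed position suffices.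
    have hshift : Measurable fun ω => Φ (shift (k + 1) (walk x ω)) := by
      have : (fun ω => Φ (shift (k + 1) (walk x ω)))
          = Function.uncurry (fun z ω => Φ (walk z ω)) ∘
            fun ω : ℕ → Fin 4 => (walk x ω (k + 1), shift (k + 1) ω) := by
        funext ω
        simp only [Function.comp, Function.uncurry]
        congr 1
        funext i
        simp [shift, walk, Finset.sum_range_add, add_assoc]
      rw [this]
      refine (measurable_from_prod_countable_right fun z => hΦ z).comp ?_
      exact (DependsUpTo.measurable (k := k + 1) (Φ := fun s => s (k + 1))
        (fun s s' h => h _ le_rfl) x).prodMk (measurable_pi_lambda _ fun i => measurable_pi_apply _)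
    rw [lintegral_stepLaw (Φ := fun ω => Ψ (walk x ω) * Φ (shift (k + 1) (walk x ω)))
      ((hΨ.measurable x).mul hshift), lintegral_stepLaw]
    · refine Finset.sum_congr rfl fun j _ => ?_
      congr 1
      simp_rw [hcons, walk_scons, scons_succ]
      exact ih (Ψ := fun s => Ψ (scons x s)) (fun s s' h => hΨ _ _ fun i hi => by
        cases i with
        | zero => rfl
        | succ i => exact h i (by omega)) _
    · refine (hΨ.measurable x).mul ?_
      exact DependsUpTo.measurable (k := k + 1)
        (Φ := fun s => ∫⁻ ω', Φ (walk (s (k + 1)) ω') ∂stepLaw)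
        (fun s s' h => by simp only [h _ le_rfl]) x

/-! ### Hitting times, stopping times and the strong Markov property. -/

lemma iInf_nat_eq_coe_iff {p : ℕ → Prop} {k : ℕ} :
    (⨅ (i : ℕ) (_ : p i), (i : ℕ∞)) = (k : ℕ∞) ↔ p k ∧ ∀ i < k, ¬ p i := by
  constructor
  · intro h
    have hlt : ∀ i < k, ¬ p i := by
      intro i hi hp
      have : (⨅ (i : ℕ) (_ : p i), (i : ℕ∞)) ≤ (i : ℕ∞) := iInf₂_le i hp
      rw [h, Nat.cast_le] at this
      omega
    refine ⟨?_, hlt⟩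
    by_contra hk
    have : ((k + 1 : ℕ) : ℕ∞) ≤ ⨅ (i : ℕ) (_ : p i), (i : ℕ∞) := by
      refine le_iInf₂ fun i hi => ?_
      rw [Nat.cast_le]
      by_contra hlt'
      rcases Nat.lt_or_ge i k with h1 | h1
      · exact hlt i h1 hi
      · obtain rfl : i = k := by omega
        exact hk hi
    rw [h, Nat.cast_le] at this
    omega
  · rintro ⟨hk, hlt⟩
    refine le_antisymm (iInf₂_le k hk) (le_iInf₂ fun i hi => ?_)
    rw [Nat.cast_le]
    by_contra h
    exact hlt i (by omega) hi

lemma iInf_nat_eq_top_iff {p : ℕ → Prop} :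
    (⨅ (i : ℕ) (_ : p i), (i : ℕ∞)) = ⊤ ↔ ∀ i, ¬ p i := by
  simp [iInf_eq_top]

lemma hit_eq_coe_iff {A : Set (Torus n)} {s : ℕ → Torus n} {k : ℕ} :
    hit A s = (k : ℕ∞) ↔ s k ∈ A ∧ ∀ i < k, s i ∉ A := iInf_nat_eq_coe_iff

lemma hit_eq_top_iff {A : Set (Torus n)} {s : ℕ → Torus n} :
    hit A s = ⊤ ↔ ∀ i, s i ∉ A := iInf_nat_eq_top_iff

lemma hitAfter_eq_coe_iff {A : Set (Torus n)} {s : ℕ → Torus n} {t k : ℕ} :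
    hitAfter A (t : ℕ∞) s = (k : ℕ∞) ↔ (t < k ∧ s k ∈ A) ∧ ∀ i < k, ¬ (t < i ∧ s i ∈ A) := by
  unfold hitAfter
  simp only [Nat.cast_lt]
  exact iInf_nat_eq_coe_iff

lemma hitAfter_top {A : Set (Torus n)} {s : ℕ → Torus n} : hitAfter A ⊤ s = ⊤ := by
  simp [hitAfter]

/-- If the path is off `A` at time `t`, then the first visit to `A` after `t` is the hitting time
of `A` by the path from time `t` on. -/
lemma hitAfter_eq_add_hit {A : Set (Torus n)} {s : ℕ → Torus n} {t : ℕ} (ht : s t ∉ A) :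
    hitAfter A (t : ℕ∞) s = t + hit A (shift t s) := by
  cases h : hit A (shift t s) with
  | top =>
    rw [hit_eq_top_iff] at h
    rw [add_top]
    unfold hitAfter
    rw [iInf_nat_eq_top_iff]
    rintro i ⟨hi, hiA⟩
    rw [Nat.cast_lt] at hi
    have := h (i - t)
    rw [shift_apply, show t + (i - t) = i by omega] at this
    exact this hiA
  | coe k =>
    rw [hit_eq_coe_iff] at h
    rw [← Nat.cast_add, hitAfter_eq_coe_iff]
    have hk : k ≠ 0 := by
      rintro rfl
      exact ht (by simpa using h.1)
    refine ⟨⟨by omega, by simpa using h.1⟩, ?_⟩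
    rintro i hi ⟨hti, hiA⟩
    have := h.2 (i - t) (by omega)
    rw [shift_apply, show t + (i - t) = i by omega] at this
    exact this hiA

/-- Whether `τ = k` depends only on the path up to time `k`. -/
def IsStop (τ : (ℕ → Torus n) → ℕ∞) : Prop := ∀ k : ℕ, DependsUpTo k fun s => τ s = (k : ℕ∞)

lemma isStop_hit (A : Set (Torus n)) : IsStop (hit A) := by
  intro k s s' h
  simp only [eq_iff_iff]
  rw [hit_eq_coe_iff, hit_eq_coe_iff, h k le_rfl]
  refine and_congr_right fun _ => forall₂_congr fun i hi => ?_
  rw [h i hi.le]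

/-- First `τ`, then `σ` for the path from time `τ` on. -/
def seqTime (τ σ : (ℕ → Torus n) → ℕ∞) (s : ℕ → Torus n) : ℕ∞ :=
  τ s + σ (shift (τ s).toNat s)

lemma seqTime_of_eq {τ σ : (ℕ → Torus n) → ℕ∞} {s : ℕ → Torus n} {k : ℕ}
    (h : τ s = (k : ℕ∞)) : seqTime τ σ s = k + σ (shift k s) := by
  simp [seqTime, h]

lemma seqTime_of_top {τ σ : (ℕ → Torus n) → ℕ∞} {s : ℕ → Torus n}
    (h : τ s = ⊤) : seqTime τ σ s = ⊤ := by
  simp [seqTime, h]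

lemma seqTime_eq_coe_iff {τ σ : (ℕ → Torus n) → ℕ∞} {s : ℕ → Torus n} {k : ℕ} :
    seqTime τ σ s = (k : ℕ∞) ↔
      ∃ i ≤ k, τ s = (i : ℕ∞) ∧ σ (shift i s) = ((k - i : ℕ) : ℕ∞) := by
  cases hτ : τ s with
  | top => simp [seqTime_of_top hτ]
  | coe i =>
    rw [seqTime_of_eq hτ]
    cases hσ : σ (shift i s) with
    | top =>
      simp only [add_top, ENat.top_ne_natCast, false_iff, not_exists, not_and]
      intro i' _ h
      obtain rfl : i = i' := by exact_mod_cast h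
      rw [hσ]
      exact ENat.top_ne_natCast _
    | coe l =>
      constructor
      · intro h
        have h' : i + l = k := by exact_mod_cast h
        exact ⟨i, by omega, rfl, by rw [hσ]; congr 1; omega⟩
      · rintro ⟨i', hi', h, h2⟩
        obtain rfl : i = i' := by exact_mod_cast h
        rw [hσ] at h2
        have h2' : l = k - i := by exact_mod_cast h2
        rw [← Nat.cast_add]
        congr 1
        omega

lemma IsStop.seqTime {τ σ : (ℕ → Torus n) → ℕ∞} (hτ : IsStop τ) (hσ : IsStop σ) :
    IsStop (seqTime τ σ) := by
  intro k s s' h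
  simp only [eq_iff_iff]
  rw [seqTime_eq_coe_iff, seqTime_eq_coe_iff]
  refine exists_congr fun i => and_congr_right fun hi => and_congr ?_ ?_
  · rw [← eq_iff_iff]
    exact hτ i s s' fun l hl => h l (hl.trans hi)
  · rw [← eq_iff_iff]
    exact hσ (k - i) _ _ fun l hl => h _ (by omega)

/-- `F (τ, S_τ)` on the event `τ < ∞`, and `0` elsewhere. -/
def stopped (τ : (ℕ → Torus n) → ℕ∞) (F : ℕ → Torus n → ℝ≥0∞) (s : ℕ → Torus n) : ℝ≥0∞ :=
  ∑' k : ℕ, if τ s = (k : ℕ∞) then F k (s k) else 0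

lemma stopped_of_eq {τ : (ℕ → Torus n) → ℕ∞} {F : ℕ → Torus n → ℝ≥0∞} {s : ℕ → Torus n} {k : ℕ}
    (h : τ s = (k : ℕ∞)) : stopped τ F s = F k (s k) := by
  unfold stopped
  rw [tsum_eq_single k]
  · simp [h]
  · intro l hl
    rw [if_neg]
    rw [h]
    exact fun h' => hl (by exact_mod_cast h'.symm)

lemma stopped_of_top {τ : (ℕ → Torus n) → ℕ∞} {F : ℕ → Torus n → ℝ≥0∞} {s : ℕ → Torus n}
    (h : τ s = ⊤) : stopped τ F s = 0 := by
  simp [stopped, h]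

lemma IsStop.dependsUpTo_ite {τ : (ℕ → Torus n) → ℕ∞} (hτ : IsStop τ) (k : ℕ)
    (G : Torus n → ℝ≥0∞) :
    DependsUpTo k fun s => if τ s = (k : ℕ∞) then G (s k) else 0 := by
  intro s s' h
  have h1 : (τ s = (k : ℕ∞)) = (τ s' = (k : ℕ∞)) := hτ k s s' h
  simp only [h1, h k le_rfl]

lemma IsStop.measurable_stopped {τ : (ℕ → Torus n) → ℕ∞} (hτ : IsStop τ)
    (F : ℕ → Torus n → ℝ≥0∞) (x : Torus n) : Measurable fun ω => stopped τ F (walk x ω) :=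
  Measurable.tsum fun k => (hτ.dependsUpTo_ite k (F k)).measurable x

/-- `E_x[F (τ, S_τ); τ < ∞]`. -/
def stoppedExp (x : Torus n) (τ : (ℕ → Torus n) → ℕ∞) (F : ℕ → Torus n → ℝ≥0∞) : ℝ≥0∞ :=
  ∫⁻ ω, stopped τ F (walk x ω) ∂stepLaw

lemma stoppedExp_mono {x : Torus n} {τ : (ℕ → Torus n) → ℕ∞} {F G : ℕ → Torus n → ℝ≥0∞}
    (h : ∀ k z, F k z ≤ G k z) : stoppedExp x τ F ≤ stoppedExp x τ G := by
  refine lintegral_mono fun ω => ENNReal.tsum_le_tsum fun k => ?_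
  split_ifs
  · exact h _ _
  · exact le_rfl

lemma stopped_seqTime {τ σ : (ℕ → Torus n) → ℕ∞} (F : ℕ → Torus n → ℝ≥0∞) (s : ℕ → Torus n) :
    stopped (seqTime τ σ) F s = ∑' k : ℕ, (if τ s = (k : ℕ∞) then 1 else 0) *
      stopped σ (fun l => F (k + l)) (shift k s) := by
  cases hτ : τ s with
  | top => rw [stopped_of_top (seqTime_of_top hτ)]; simp
  | coe i =>
    rw [tsum_eq_single i]
    · rw [if_pos rfl, one_mul]
      cases hσ : σ (shift i s) with
      | top =>
        rw [stopped_of_top hσ, stopped_of_top]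
        rw [seqTime_of_eq hτ, hσ, add_top]
      | coe l =>
        rw [stopped_of_eq hσ, stopped_of_eq (k := i + l), shift_apply]
        rw [seqTime_of_eq hτ, hσ, Nat.cast_add]
    · intro k hk
      rw [if_neg, zero_mul]
      exact fun h => hk (by exact_mod_cast h.symm)

lemma stoppedExp_eq_tsum {τ : (ℕ → Torus n) → ℕ∞} (hτ : IsStop τ) (x : Torus n)
    (F : ℕ → Torus n → ℝ≥0∞) : stoppedExp x τ F
      = ∑' k : ℕ, ∫⁻ ω, (if τ (walk x ω) = (k : ℕ∞) then F k (walk x ω k) else 0) ∂stepLaw :=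
  lintegral_tsum (f := fun (k : ℕ) ω => if τ (walk x ω) = (k : ℕ∞) then F k (walk x ω k) else 0)
    fun k => ((hτ.dependsUpTo_ite k (F k)).measurable x).aemeasurable

/-- The strong Markov property. -/
lemma stoppedExp_seqTime [NeZero n] {τ σ : (ℕ → Torus n) → ℕ∞} (hτ : IsStop τ) (hσ : IsStop σ)
    (x : Torus n) (F : ℕ → Torus n → ℝ≥0∞) :
    stoppedExp x (seqTime τ σ) F
      = stoppedExp x τ fun k z => stoppedExp z σ fun l => F (k + l) := by
  have hdep : ∀ k : ℕ, DependsUpTo k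
      (fun s : ℕ → Torus n => if τ s = (k : ℕ∞) then (1 : ℝ≥0∞) else 0) :=
    fun k => hτ.dependsUpTo_ite k fun _ => 1
  have hshift : ∀ k, Measurable fun ω => stopped σ (fun l => F (k + l)) (shift k (walk x ω)) := by
    intro k
    refine Measurable.tsum fun l => ?_
    refine DependsUpTo.measurable (k := k + l)
      (Φ := fun s => if σ (shift k s) = (l : ℕ∞) then F (k + l) (shift k s l) else 0) ?_ x
    intro s s' h
    exact hσ.dependsUpTo_ite l (F (k + l)) _ _ fun i hi => h _ (by omega)
  rw [stoppedExp_eq_tsum hτ]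
  unfold stoppedExp
  -- Splitting over the values of τ reduces the claim to the Markov property at deterministic times.
  simp_rw [stopped_seqTime]
  rw [lintegral_tsum (f := fun (k : ℕ) ω => (if τ (walk x ω) = (k : ℕ∞) then (1 : ℝ≥0∞) else 0) *
    stopped σ (fun l => F (k + l)) (shift k (walk x ω)))
    fun k => (((hdep k).measurable x).mul (hshift k)).aemeasurable]
  refine tsum_congr fun k => ?_
  refine (lintegral_mul_shift (fun z => hσ.measurable_stopped _ z) k (hdep k) x).trans ?_
  refine lintegral_congr fun ω => ?_
  split_ifs <;> simp

lemma hit_scons_of_notMem {A : Set (Torus n)} {x : Torus n} (hx : x ∉ A) (s : ℕ → Torus n) :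
    hit A (scons x s) = hit A s + 1 := by
  cases h : hit A s with
  | top =>
    rw [top_add, hit_eq_top_iff]
    rw [hit_eq_top_iff] at h
    intro i
    cases i with
    | zero => exact hx
    | succ i => exact h i
  | coe k =>
    rw [hit_eq_coe_iff] at h
    rw [show (k : ℕ∞) + 1 = ((k + 1 : ℕ) : ℕ∞) by norm_cast, hit_eq_coe_iff]
    refine ⟨h.1, fun i hi => ?_⟩
    cases i with
    | zero => exact hx
    | succ i => exact h.2 i (by omega)

lemma stoppedExp_hit_of_mem {A : Set (Torus n)} {x : Torus n} (hx : x ∈ A)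
    (F : ℕ → Torus n → ℝ≥0∞) : stoppedExp x (hit A) F = F 0 x := by
  have h : ∀ ω, stopped (hit A) F (walk x ω) = F 0 x := by
    intro ω
    rw [stopped_of_eq (k := 0), walk_zero]
    rw [hit_eq_coe_iff]
    exact ⟨by simpa using hx, fun i hi => absurd hi (Nat.not_lt_zero i)⟩
  simp [stoppedExp, h]

lemma stoppedExp_hit_of_notMem {A : Set (Torus n)} {x : Torus n} (hx : x ∉ A)
    (F : ℕ → Torus n → ℝ≥0∞) : stoppedExp x (hit A) F
      = ∑ j : Fin 4, (4 : ℝ≥0∞)⁻¹ * stoppedExp (x + unitStep n j) (hit A) fun k => F (k + 1) := by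
  unfold stoppedExp
  rw [lintegral_walk fun x => (isStop_hit A).measurable_stopped F x]
  refine Finset.sum_congr rfl fun j _ => ?_
  congr 1
  refine lintegral_congr fun ω => ?_
  have h := hit_scons_of_notMem hx (walk (x + unitStep n j) ω)
  cases h' : hit A (walk (x + unitStep n j) ω) with
  | top => rw [stopped_of_top h', stopped_of_top (by rw [h, h', top_add])]
  | coe k =>
    rw [stopped_of_eq h', stopped_of_eq (k := k + 1) (by rw [h, h']; norm_cast), scons_succ]

lemma prob_stopped_at {τ : (ℕ → Torus n) → ℕ∞} (hτ : IsStop τ) (x z : Torus n) :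
    prob x {s | ∃ k : ℕ, τ s = (k : ℕ∞) ∧ s k = z}
      = stoppedExp x τ fun _ w => if w = z then 1 else 0 := by
  classical
  set E : Set (ℕ → Torus n) := {s | ∃ k : ℕ, τ s = (k : ℕ∞) ∧ s k = z} with hE
  have hind : ∀ s, stopped τ (fun _ w => if w = z then (1 : ℝ≥0∞) else 0) s
      = if s ∈ E then 1 else 0 := by
    intro s
    rcases eq_or_ne (τ s) ⊤ with h | h
    · rw [stopped_of_top h]
      simp [hE, h]
    · obtain ⟨k, h⟩ := ENat.ne_top_iff_exists.1 h
      rw [stopped_of_eq h.symm]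
      simp [hE, ← h]
  have hm := hτ.measurable_stopped (fun _ w => if w = z then (1 : ℝ≥0∞) else 0) x
  simp_rw [hind] at hm
  have hset : MeasurableSet {ω | walk x ω ∈ E} := by
    convert hm (MeasurableSet.singleton 1) using 1
    ext ω
    by_cases h : walk x ω ∈ E <;> simp [h]
  unfold stoppedExp prob
  simp_rw [hind]
  rw [← lintegral_indicator_one hset]
  refine lintegral_congr fun ω => ?_
  simp [Set.indicator_apply]

lemma prob_hitAt (A : Set (Torus n)) (x z : Torus n) :
    prob x (hitAt A z) = stoppedExp x (hit A) fun _ w => if w = z then 1 else 0 :=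
  prob_stopped_at (isStop_hit A) x z

/-! ### Exponential moments of hitting times from bounded supersolutions. -/

open Classical in
/-- `ζ ^ min (H_A, N)`. -/
def truncPow (A : Set (Torus n)) (ζ : ℝ≥0∞) : ℕ → (ℕ → Torus n) → ℝ≥0∞
  | 0, _ => 1
  | N + 1, s => if s 0 ∈ A then 1 else ζ * truncPow A ζ N (shift 1 s)

lemma truncPow_dependsUpTo (A : Set (Torus n)) (ζ : ℝ≥0∞) (N : ℕ) :
    DependsUpTo N (truncPow A ζ N) := by
  induction N with
  | zero => intro s s' _; rfl
  | succ N ih =>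
    intro s s' h
    have h0 := h 0 (Nat.zero_le _)
    simp only [truncPow, ih (shift 1 s) (shift 1 s') fun i hi => h _ (by omega)]
    by_cases hs : s 0 ∈ A
    · rw [if_pos hs, if_pos (h0 ▸ hs)]
    · rw [if_neg hs, if_neg (h0 ▸ hs)]

lemma truncPow_of_eq {A : Set (Torus n)} (ζ : ℝ≥0∞) (N : ℕ) :
    ∀ {s : ℕ → Torus n} {k : ℕ}, (∀ i < k, s i ∉ A) → s k ∈ A → k ≤ N →
      truncPow A ζ N s = ζ ^ k := by
  induction N with
  | zero =>
    intro s k _ _ hk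
    obtain rfl : k = 0 := by omega
    simp [truncPow]
  | succ N ih =>
    intro s k h hA hk
    cases k with
    | zero => simp [truncPow, hA]
    | succ k =>
      rw [truncPow, if_neg (h 0 (Nat.succ_pos k)), pow_succ', ih (k := k)]
      · intro i hi
        rw [shift_apply, add_comm]
        exact h _ (by omega)
      · rw [shift_apply, add_comm]
        exact hA
      · omega

lemma truncPow_of_forall {A : Set (Torus n)} (ζ : ℝ≥0∞) (N : ℕ) :
    ∀ {s : ℕ → Torus n}, (∀ i, s i ∉ A) → truncPow A ζ N s = ζ ^ N := by
  induction N with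
  | zero => intro s _; simp [truncPow]
  | succ N ih =>
    intro s h
    rw [truncPow, if_neg (h 0), pow_succ', ih (s := shift 1 s) fun i => h _]

/-- A bounded supersolution controls exponential moments of the hitting time. -/
lemma lintegral_truncPow_le {A : Set (Torus n)} {f : Torus n → ℝ} {Λ : ℝ} (hΛ : 0 < Λ)
    (hf0 : ∀ x, 0 ≤ f x) (hfΛ : ∀ x, f x ≤ Λ)
    (hf : ∀ x ∉ A, ∑ j : Fin 4, f (x + unitStep n j) ≤ 4 * (f x - 1)) (N : ℕ) :
    ∀ x, ∫⁻ ω, truncPow A (ENNReal.ofReal (Real.exp (1 / (2 * Λ)))) N (walk x ω) ∂stepLaw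
      ≤ ENNReal.ofReal (1 + f x / Λ) := by
  set c : ℝ := 1 / (2 * Λ) with hc
  induction N with
  | zero =>
    intro x
    have : 0 ≤ f x / Λ := div_nonneg (hf0 x) hΛ.le
    simp only [truncPow, lintegral_const, measure_univ, mul_one]
    rw [← ENNReal.ofReal_one]
    exact ENNReal.ofReal_le_ofReal (by linarith)
  | succ N ih =>
    intro x
    by_cases hx : x ∈ A
    · have : 0 ≤ f x / Λ := div_nonneg (hf0 x) hΛ.le
      simp only [truncPow, walk_zero, hx, if_true, lintegral_const, measure_univ, mul_one]
      rw [← ENNReal.ofReal_one]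
      exact ENNReal.ofReal_le_ofReal (by linarith)
    · rw [lintegral_walk fun x => (truncPow_dependsUpTo A _ (N + 1)).measurable x]
      have h1 : ∀ j, ∫⁻ ω, truncPow A (ENNReal.ofReal (Real.exp c)) (N + 1)
          (scons x (walk (x + unitStep n j) ω)) ∂stepLaw
          ≤ ENNReal.ofReal (Real.exp c) * ENNReal.ofReal (1 + f (x + unitStep n j) / Λ) := by
        intro j
        simp only [truncPow, scons_zero, hx, if_false, shift_succ_scons, shift_zero]
        rw [lintegral_const_mul _ ((truncPow_dependsUpTo A _ N).measurable _)]
        exact mul_le_mul_right (ih _) _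
      refine (Finset.sum_le_sum fun j _ => mul_le_mul_right (h1 j) _).trans ?_
      have h4 : (4 : ℝ≥0∞)⁻¹ = ENNReal.ofReal (1 / 4) := by
        rw [one_div, ENNReal.ofReal_inv_of_pos (by norm_num)]
        norm_num
      have hpos : ∀ j, 0 ≤ 1 + f (x + unitStep n j) / Λ := fun j =>
        add_nonneg zero_le_one (div_nonneg (hf0 _) hΛ.le)
      simp_rw [h4, ← ENNReal.ofReal_mul (Real.exp_pos c).le,
        ← ENNReal.ofReal_mul (show (0 : ℝ) ≤ 1 / 4 by norm_num)]
      rw [← ENNReal.ofReal_sum_of_nonneg fun j _ =>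
        mul_nonneg (by norm_num) (mul_nonneg (Real.exp_pos c).le (hpos j))]
      refine ENNReal.ofReal_le_ofReal ?_
      have hsum : ∑ j : Fin 4, 1 / 4 * (Real.exp c * (1 + f (x + unitStep n j) / Λ))
          = Real.exp c * (1 + (∑ j : Fin 4, f (x + unitStep n j)) / 4 / Λ) := by
        simp only [Fin.sum_univ_four]
        field_simp
        ring
      rw [hsum]
      have h2 : (∑ j : Fin 4, f (x + unitStep n j)) / 4 / Λ ≤ f x / Λ - 2 * c := by
        rw [hc, show f x / Λ - 2 * (1 / (2 * Λ)) = (f x - 1) / Λ by field_simp]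
        exact div_le_div_of_nonneg_right (by linarith [hf x hx]) hΛ.le
      have h3 : f x / Λ ≤ 1 := (div_le_one hΛ).2 (hfΛ x)
      have hc0 : 0 < c := by positivity
      have h5 : 1 - c ≤ Real.exp (-c) := by linarith [Real.add_one_le_exp (-c)]
      have h6 : 0 ≤ f x / Λ := div_nonneg (hf0 x) hΛ.le
      -- With u = f x / Λ ≤ 1 the neighbours contribute at most 1 + u − 2c ≤ (1 + u)(1 − c) ≤ (1 +
      -- u)e^{−c}. The gain 2c has to beat c(1 + u), which is why the rate is 1/(2Λ) and not 1/Λ.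
      calc Real.exp c * (1 + (∑ j : Fin 4, f (x + unitStep n j)) / 4 / Λ)
          ≤ Real.exp c * ((1 + f x / Λ) * Real.exp (-c)) := by
            refine mul_le_mul_of_nonneg_left ?_ (Real.exp_pos c).le
            nlinarith
        _ = 1 + f x / Λ := by
            rw [mul_comm (1 + f x / Λ), ← mul_assoc, ← Real.exp_add]
            simp

/-- `τ` is almost surely finite with `E_x[exp (τ / (2 Λ))] ≤ C`, for every starting point. -/
structure HasExpBound (τ : (ℕ → Torus n) → ℕ∞) (Λ C : ℝ) : Prop where
  ae_ne_top : ∀ x, ∀ᵐ ω ∂stepLaw, τ (walk x ω) ≠ ⊤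
  exp_le : ∀ x, stoppedExp x τ (fun k _ => ENNReal.ofReal (Real.exp (k / (2 * Λ))))
    ≤ ENNReal.ofReal C

/-- Fatou's lemma lets the truncation level tend to infinity in `lintegral_truncPow_le`. Since ζ >
1, the limit is infinite where `A` is never hit, so the same bound also yields almost sure
finiteness. -/
lemma hasExpBound_hit {A : Set (Torus n)} {f : Torus n → ℝ} {Λ : ℝ} (hΛ : 0 < Λ)
    (hf0 : ∀ x, 0 ≤ f x) (hfΛ : ∀ x, f x ≤ Λ)
    (hf : ∀ x ∉ A, ∑ j : Fin 4, f (x + unitStep n j) ≤ 4 * (f x - 1)) :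
    HasExpBound (hit A) Λ 2 := by
  set ζ : ℝ≥0∞ := ENNReal.ofReal (Real.exp (1 / (2 * Λ))) with hζ
  have hmeas : ∀ x N, Measurable fun ω => truncPow A ζ N (walk x ω) :=
    fun x N => (truncPow_dependsUpTo A ζ N).measurable x
  have hbound : ∀ x, ∫⁻ ω, Filter.liminf (fun N => truncPow A ζ N (walk x ω)) Filter.atTop
      ∂stepLaw ≤ ENNReal.ofReal 2 := by
    intro x
    refine (lintegral_liminf_le fun N => hmeas x N).trans ?_
    refine Filter.liminf_le_of_frequently_le' (Filter.Frequently.of_forall fun N => ?_)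
    refine (lintegral_truncPow_le hΛ hf0 hfΛ hf N x).trans (ENNReal.ofReal_le_ofReal ?_)
    linarith [(div_le_one hΛ).2 (hfΛ x)]
  have hζ1 : 1 < ζ := by
    rw [hζ, ← ENNReal.ofReal_one, ENNReal.ofReal_lt_ofReal_iff (Real.exp_pos _)]
    exact Real.one_lt_exp_iff.2 (by positivity)
  have hζpow : ∀ k : ℕ, ζ ^ k = ENNReal.ofReal (Real.exp (k / (2 * Λ))) := by
    intro k
    rw [hζ, ← ENNReal.ofReal_pow (Real.exp_pos _).le, ← Real.exp_nat_mul]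
    congr 2
    ring
  refine ⟨fun x => ?_, fun x => ?_⟩
  · have hlt := ae_lt_top (Measurable.liminf fun N => hmeas x N)
      ((hbound x).trans_lt ENNReal.ofReal_lt_top).ne
    filter_upwards [hlt] with ω hω htop
    rw [hit_eq_top_iff] at htop
    simp_rw [truncPow_of_forall ζ _ htop] at hω
    rw [(ENNReal.tendsto_pow_atTop_nhds_top_iff.2 hζ1).liminf_eq] at hω
    exact lt_irrefl _ hω
  · refine le_trans (lintegral_mono fun ω => ?_) (hbound x)
    rcases eq_or_ne (hit A (walk x ω)) ⊤ with h | h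
    · simp [stopped_of_top h]
    · obtain ⟨k, h⟩ := ENat.ne_top_iff_exists.1 h
      rw [stopped_of_eq h.symm, ← hζpow]
      have hk := hit_eq_coe_iff.1 h.symm
      have : Filter.Tendsto (fun N => truncPow A ζ N (walk x ω)) Filter.atTop
          (nhds (ζ ^ k)) := by
        refine tendsto_const_nhds.congr' ?_
        filter_upwards [Filter.eventually_ge_atTop k] with N hN
        exact (truncPow_of_eq ζ N hk.2 hk.1 hN).symm
      rw [this.liminf_eq]

lemma HasExpBound.stoppedExp_const {τ : (ℕ → Torus n) → ℕ∞} {Λ C : ℝ} (h : HasExpBound τ Λ C)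
    (x : Torus n) (c : ℝ≥0∞) : stoppedExp x τ (fun _ _ => c) = c := by
  unfold stoppedExp
  rw [lintegral_congr_ae (g := fun _ => c)]
  · simp
  · filter_upwards [h.ae_ne_top x] with ω hω
    obtain ⟨k, hk⟩ := ENat.ne_top_iff_exists.1 hω
    rw [stopped_of_eq hk.symm]

/-- Almost sure finiteness becomes an identity for `stoppedExp`, a form that the strong Markov
property transports to composed times. -/
lemma ae_ne_top_iff {τ : (ℕ → Torus n) → ℕ∞} (hτ : IsStop τ) (x : Torus n) :
    (∀ᵐ ω ∂stepLaw, τ (walk x ω) ≠ ⊤) ↔ stoppedExp x τ (fun _ _ => 1) = 1 := by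
  have hite : ∀ s, stopped τ (fun _ _ => (1 : ℝ≥0∞)) s = if τ s = ⊤ then 0 else 1 := by
    intro s
    rcases eq_or_ne (τ s) ⊤ with h | h
    · simp [stopped_of_top h, h]
    · obtain ⟨k, hk⟩ := ENat.ne_top_iff_exists.1 h
      rw [stopped_of_eq hk.symm, if_neg h]
  have hm := hτ.measurable_stopped (fun _ _ => 1) x
  have hset : MeasurableSet {ω | τ (walk x ω) ≠ ⊤} := by
    convert hm (MeasurableSet.singleton 1) using 1
    ext ω
    by_cases h : τ (walk x ω) = ⊤ <;> simp [hite, h]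
  have hE : stoppedExp x τ (fun _ _ => 1) = stepLaw {ω | τ (walk x ω) ≠ ⊤} := by
    unfold stoppedExp
    rw [← lintegral_indicator_one hset]
    refine lintegral_congr fun ω => ?_
    by_cases h : τ (walk x ω) = ⊤ <;> simp [hite, h]
  rw [hE]
  rw [← prob_compl_eq_zero_iff (μ := stepLaw) hset]
  rfl

/-- The exponential factorises over the two stages, and the bound for σ is uniform in its starting
point. The scale Λ is unchanged and only the constants multiply. -/
lemma HasExpBound.seqTime [NeZero n] {τ σ : (ℕ → Torus n) → ℕ∞} {Λ C C' : ℝ}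
    (hτs : IsStop τ) (hσs : IsStop σ) (hC : 0 ≤ C)
    (hτ : HasExpBound τ Λ C) (hσ : HasExpBound σ Λ C') :
    HasExpBound (seqTime τ σ) Λ (C * C') := by
  refine ⟨fun x => ?_, fun x => ?_⟩
  · rw [ae_ne_top_iff (hτs.seqTime hσs), stoppedExp_seqTime hτs hσs]
    simp_rw [hσ.stoppedExp_const]
    exact hτ.stoppedExp_const x 1
  · rw [stoppedExp_seqTime hτs hσs]
    have h1 : ∀ (k : ℕ) (z : Torus n), stoppedExp z σ (fun l (_ : Torus n) =>
        ENNReal.ofReal (Real.exp (((k + l : ℕ) : ℝ) / (2 * Λ))))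
        ≤ ENNReal.ofReal (Real.exp (k / (2 * Λ))) * ENNReal.ofReal C' := by
      intro k z
      refine le_trans (le_of_eq ?_) (mul_le_mul_right (hσ.exp_le z) _)
      unfold stoppedExp
      rw [← lintegral_const_mul _ (hσs.measurable_stopped _ z)]
      refine lintegral_congr fun ω => ?_
      rcases eq_or_ne (σ (walk z ω)) ⊤ with h | h
      · simp [stopped_of_top h]
      · obtain ⟨l, hl⟩ := ENat.ne_top_iff_exists.1 h
        rw [stopped_of_eq hl.symm, stopped_of_eq hl.symm, ← ENNReal.ofReal_mul (Real.exp_pos _).le,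
          ← Real.exp_add]
        congr 2
        push_cast
        ring
    refine (stoppedExp_mono fun k z => h1 k z).trans ?_
    rw [ENNReal.ofReal_mul hC]
    refine le_trans (le_of_eq ?_) (mul_le_mul_left (hτ.exp_le x) _)
    unfold stoppedExp
    rw [← lintegral_mul_const _ (hτs.measurable_stopped _ x)]
    refine lintegral_congr fun ω => ?_
    rcases eq_or_ne (τ (walk x ω)) ⊤ with h | h
    · simp [stopped_of_top h]
    · obtain ⟨l, hl⟩ := ENat.ne_top_iff_exists.1 h
      rw [stopped_of_eq hl.symm, stopped_of_eq hl.symm]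

/-! ### The logarithmic potential and its drift. -/

/-- Here p = 1 − cos a, s = 1 − cos b, G = p + s − 2ε, and the two factors are the products of G
over opposite neighbours. The first-order terms ±(s − p) cancel, which reflects harmonicity of the
logarithm. Close to the singularity the error ε²G² would be too large; the shift by 2ε gives it the
coefficient −6 + 4(p + s) ≤ −2 + 48G², whose negative part absorbs the remaining small errors and
leaves only a multiple of ε²G⁴. -/
lemma prod_neighbours_le {p s ε : ℝ} (hp0 : 0 ≤ p) (hp2 : p ≤ 2) (hs0 : 0 ≤ s) (hs2 : s ≤ 2)
    (hε0 : 0 ≤ ε) (hε : ε ≤ 1 / 500) (hg : 100 * ε ≤ p + s) :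
    ((p + s - 2 * ε) ^ 2 + 2 * ε * (s - p - p * s - 2 * ε * (1 - p)) + ε ^ 2) *
      ((p + s - 2 * ε) ^ 2 + 2 * ε * (p - s - p * s - 2 * ε * (1 - s)) + ε ^ 2)
      ≤ (p + s - 2 * ε) ^ 4 - 4 * ε * (p * s) * (p + s - 2 * ε) ^ 2
        + 52 * ε ^ 2 * (p + s - 2 * ε) ^ 4 := by
  set G : ℝ := p + s - 2 * ε with hG
  have hGε : 98 * ε ≤ G := by linarith
  have hG0 : 0 ≤ G := by linarith
  have hgG : p + s ≤ 2 * G := by linarith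
  have hg2 : (p + s) ^ 2 ≤ 4 * G ^ 2 := by nlinarith
  have ht0 : 0 ≤ p * s := mul_nonneg hp0 hs0
  have ht1 : p * s ≤ G ^ 2 := by nlinarith [sq_nonneg (p - s)]
  have hps : (1 - p) * (1 - s) ≤ 1 := by nlinarith
  have hε2 : ε ^ 2 ≤ G ^ 2 / 9604 := by nlinarith
  have e1 : (4 * (p + s) - 4) ≤ 48 * G ^ 2 := by
    by_cases h : p + s ≤ 1
    · nlinarith [sq_nonneg G]
    · have : 1 / 2 ≤ G := by linarith
      nlinarith
  have e2 : (ε - 2 * (p * s)) ^ 2 ≤ ε ^ 2 + 4 * G ^ 4 := by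
    have : (p * s) ^ 2 ≤ G ^ 4 := by nlinarith
    nlinarith [mul_nonneg hε0 ht0]
  have e3 : -(4 * (ε - 2 * (p * s)) * (2 - (p + s))) ≤ 8 * ε + 16 * G ^ 2 := by
    have h1 : -2 ≤ 2 - (p + s) := by linarith
    have h2 : 2 - (p + s) ≤ 2 := by linarith
    nlinarith [mul_nonneg hε0 (by linarith : 0 ≤ 2 + (2 - (p + s))),
      mul_nonneg ht0 (by linarith : 0 ≤ 2 - (2 - (p + s)))]
  have key : ((G) ^ 2 + 2 * ε * (s - p - p * s - 2 * ε * (1 - p)) + ε ^ 2) *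
      ((G) ^ 2 + 2 * ε * (p - s - p * s - 2 * ε * (1 - s)) + ε ^ 2)
      = G ^ 4 - 4 * ε * (p * s) * G ^ 2
        + ε ^ 2 * (G ^ 2 * (-6 + 4 * (p + s)) + (ε - 2 * (p * s)) ^ 2 - (4 - 8 * ε) * (s - p) ^ 2
          + ε * -(4 * (ε - 2 * (p * s)) * (2 - (p + s))) + 16 * ε ^ 2 * ((1 - p) * (1 - s))) := by
    ring
  rw [key]
  have e4 : 0 ≤ (4 - 8 * ε) * (s - p) ^ 2 := mul_nonneg (by linarith) (sq_nonneg _)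
  have e5 : G ^ 2 * (-6 + 4 * (p + s)) ≤ G ^ 2 * (-2 + 48 * G ^ 2) :=
    mul_le_mul_of_nonneg_left (by linarith) (sq_nonneg _)
  have e6 : ε * -(4 * (ε - 2 * (p * s)) * (2 - (p + s))) ≤ ε * (8 * ε + 16 * G ^ 2) :=
    mul_le_mul_of_nonneg_left e3 hε0
  have e7 : 16 * ε ^ 2 * ((1 - p) * (1 - s)) ≤ 16 * ε ^ 2 * 1 :=
    mul_le_mul_of_nonneg_left hps (by positivity)
  have e8 : ε * G ^ 2 ≤ G ^ 2 / 500 := by nlinarith [sq_nonneg G]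
  have e9 : G ^ 2 * (-6 + 4 * (p + s)) + (ε - 2 * (p * s)) ^ 2 - (4 - 8 * ε) * (s - p) ^ 2
          + ε * -(4 * (ε - 2 * (p * s)) * (2 - (p + s))) + 16 * ε ^ 2 * ((1 - p) * (1 - s))
        ≤ 52 * G ^ 4 := by linarith [sq_nonneg G]
  linarith [mul_le_mul_of_nonneg_left e9 (sq_nonneg ε)]

/-- The last two terms sum to (ps − 1)/16, and ps/16 ≤ ps/(p + s)² because p + s ≤ 4. The logarithm
alone contributes −ps/(p + s)², which vanishes on the axes; the corrections in `logPot` are chosen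
to make the total drift uniform. -/
lemma drift_bracket_le {p s : ℝ} (hp0 : 0 ≤ p) (hp2 : p ≤ 2) (hs0 : 0 ≤ s) (hs2 : s ≤ 2)
    (hg : 0 < p + s) :
    -(p * s / (p + s) ^ 2) - (2 - (p + s)) / 16 + (1 - p) * (1 - s) / 16 ≤ -(1 / 16) := by
  have h : p * s / (p + s) ^ 2 ≥ (p * s) / 16 := by
    apply div_le_div_of_nonneg_left (mul_nonneg hp0 hs0) (by positivity)
    nlinarith
  nlinarith

/-- The function `log (g - 2ε) - g/8 - cos a cos b / 16`, where `g = 2 - cos a - cos b`. -/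
def logPot (ε a b : ℝ) : ℝ :=
  Real.log (2 - Real.cos a - Real.cos b - 2 * ε) - (2 - Real.cos a - Real.cos b) / 8
    - Real.cos a * Real.cos b / 16

/-- In the product of opposite neighbours the sines occur only squared, so it is a polynomial in the
cosines. Sum and product of the two values are positive, hence so is each value. -/
lemma neighbour_pair {a b θ ε : ℝ} (hε : ε = 1 - Real.cos θ) (hε1 : ε ≤ 1 / 500)
    (hg0 : 0 < 2 - Real.cos a - Real.cos b) (hg : 100 * ε ≤ 2 - Real.cos a - Real.cos b) :
    0 < 2 - Real.cos (a + θ) - Real.cos b - 2 * ε ∧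
    0 < 2 - Real.cos (a - θ) - Real.cos b - 2 * ε ∧
    (2 - Real.cos (a + θ) - Real.cos b - 2 * ε) * (2 - Real.cos (a - θ) - Real.cos b - 2 * ε)
      = (2 - Real.cos a - Real.cos b - 2 * ε) ^ 2 + 2 * ε * ((1 - Real.cos b) - (1 - Real.cos a)
        - (1 - Real.cos a) * (1 - Real.cos b) - 2 * ε * (1 - (1 - Real.cos a))) + ε ^ 2 := by
  have hε0 : 0 ≤ ε := by linarith [Real.cos_le_one θ]
  have hc : Real.cos θ = 1 - ε := by linarith
  have hs : Real.sin θ ^ 2 = 1 - (1 - ε) ^ 2 := by rw [← hc]; exact Real.sin_sq θ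
  have hsa : Real.sin a ^ 2 = 1 - Real.cos a ^ 2 := Real.sin_sq a
  have hb1 := Real.cos_le_one b
  have ha1 := Real.cos_le_one a
  have ha2 := Real.neg_one_le_cos a
  rw [Real.cos_add, Real.cos_sub, hc]
  set u := Real.cos a
  set v := Real.cos b
  have hprod : (2 - (u * (1 - ε) - Real.sin a * Real.sin θ) - v - 2 * ε) *
      (2 - (u * (1 - ε) + Real.sin a * Real.sin θ) - v - 2 * ε)
      = (2 - u - v - 2 * ε + u * ε) ^ 2 - Real.sin a ^ 2 * Real.sin θ ^ 2 := by ring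
  have hsum : 0 < 2 - u - v - 2 * ε + u * ε := by nlinarith
  have hpos : 0 < (2 - u - v - 2 * ε + u * ε) ^ 2 - Real.sin a ^ 2 * Real.sin θ ^ 2 := by
    rw [hs, hsa]
    have h1 : 97 / 100 * (2 - u - v) ≤ 2 - u - v - 2 * ε + u * ε := by nlinarith
    have h2 : (97 / 100 * (2 - u - v)) ^ 2 ≤ (2 - u - v - 2 * ε + u * ε) ^ 2 :=
      pow_le_pow_left₀ (by linarith) h1 2
    have h3 : (1 - u ^ 2) * (1 - (1 - ε) ^ 2) ≤ (2 * (2 - u - v)) * (2 * ε) := by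
      apply mul_le_mul <;> nlinarith
    nlinarith
  refine ⟨?_, ?_, ?_⟩
  · by_contra hneg
    push Not at hneg
    have h2 : 0 < 2 - (u * (1 - ε) + Real.sin a * Real.sin θ) - v - 2 * ε := by nlinarith
    nlinarith [mul_nonneg h2.le (neg_nonneg.2 hneg)]
  · by_contra hneg
    push Not at hneg
    have h2 : 0 < 2 - (u * (1 - ε) - Real.sin a * Real.sin θ) - v - 2 * ε := by nlinarith
    nlinarith [mul_nonneg h2.le (neg_nonneg.2 hneg)]
  · rw [hprod, hs, hsa]
    ring

/-- By log x ≤ x − 1, the product bound gives a logarithmic drift of at most −4εt/G² + 52ε², where t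
= (1 − cos a)(1 − cos b). The corrections bring this to −ε/4 + 52ε², and 52ε² ≤ 52ε/500 < ε/8. -/
lemma logPot_drift {a b θ ε : ℝ} (hε : ε = 1 - Real.cos θ) (hε1 : ε ≤ 1 / 500)
    (hg0 : 0 < 2 - Real.cos a - Real.cos b) (hg : 100 * ε ≤ 2 - Real.cos a - Real.cos b) :
    logPot ε (a + θ) b + logPot ε (a - θ) b + logPot ε a (b + θ) + logPot ε a (b - θ)
      ≤ 4 * logPot ε a b - ε / 8 := by
  have hε0 : 0 ≤ ε := by linarith [Real.cos_le_one θ]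
  have hc : Real.cos θ = 1 - ε := by linarith
  obtain ⟨h1, h2, h12⟩ := neighbour_pair hε hε1 hg0 hg
  obtain ⟨h3, h4, h34⟩ := neighbour_pair (a := b) (b := a) hε hε1 (by linarith) (by linarith)
  have hu1 := Real.cos_le_one a
  have hu2 := Real.neg_one_le_cos a
  have hv1 := Real.cos_le_one b
  have hv2 := Real.neg_one_le_cos b
  have hprod := prod_neighbours_le (p := 1 - Real.cos a) (s := 1 - Real.cos b) (ε := ε)
    (by linarith) (by linarith) (by linarith) (by linarith) hε0 hε1 (by linarith)
  have hbr := drift_bracket_le (p := 1 - Real.cos a) (s := 1 - Real.cos b)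
    (by linarith) (by linarith) (by linarith) (by linarith) (by linarith)
  have hsuma : Real.cos (a + θ) + Real.cos (a - θ) = 2 * Real.cos a * (1 - ε) := by
    rw [Real.cos_add, Real.cos_sub, hc]; ring
  have hsumb : Real.cos (b + θ) + Real.cos (b - θ) = 2 * Real.cos b * (1 - ε) := by
    rw [Real.cos_add, Real.cos_sub, hc]; ring
  set G : ℝ := 2 - Real.cos a - Real.cos b - 2 * ε with hG
  have hGpos : 0 < G := by linarith
  set P1 := 2 - Real.cos (a + θ) - Real.cos b - 2 * ε with hP1
  set P2 := 2 - Real.cos (a - θ) - Real.cos b - 2 * ε with hP2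
  have e3 : 2 - Real.cos a - Real.cos (b + θ) - 2 * ε
    = 2 - Real.cos (b + θ) - Real.cos a - 2 * ε := by ring
  have e4 : 2 - Real.cos a - Real.cos (b - θ) - 2 * ε
    = 2 - Real.cos (b - θ) - Real.cos a - 2 * ε := by ring
  set P3 := 2 - Real.cos (b + θ) - Real.cos a - 2 * ε with hP3
  set P4 := 2 - Real.cos (b - θ) - Real.cos a - 2 * ε with hP4
  have hGpq : 1 - Real.cos a + (1 - Real.cos b) - 2 * ε = G := by rw [hG]; ring
  have hG' : 2 - Real.cos b - Real.cos a - 2 * ε = G := by rw [hG]; ring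
  rw [hGpq] at hprod
  rw [hG'] at h34
  set t := (1 - Real.cos a) * (1 - Real.cos b) with ht
  have ht0 : 0 ≤ t := mul_nonneg (by linarith) (by linarith)
  have hPi : P1 * P2 * (P3 * P4) ≤ G ^ 4 - 4 * ε * t * G ^ 2 + 52 * ε ^ 2 * G ^ 4 := by
    rw [h12, h34, mul_comm (1 - Real.cos b)]
    exact hprod
  have hlog : Real.log P1 + Real.log P2 + Real.log P3 + Real.log P4 - 4 * Real.log G
      ≤ -(4 * ε * (t / G ^ 2)) + 52 * ε ^ 2 := by
    have hE : Real.log P1 + Real.log P2 + Real.log P3 + Real.log P4 - 4 * Real.log G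
        = Real.log (P1 * P2 * (P3 * P4) / G ^ 4) := by
      rw [Real.log_div (by positivity) (by positivity), Real.log_mul (by positivity) (by positivity),
        Real.log_mul h1.ne' h2.ne', Real.log_mul h3.ne' h4.ne', Real.log_pow]
      push_cast
      ring
    rw [hE]
    refine (Real.log_le_sub_one_of_pos (by positivity)).trans ?_
    have : P1 * P2 * (P3 * P4) / G ^ 4
        ≤ (G ^ 4 - 4 * ε * t * G ^ 2 + 52 * ε ^ 2 * G ^ 4) / G ^ 4 :=
      div_le_div_of_nonneg_right hPi (by positivity)
    refine (sub_le_sub_right this 1).trans (le_of_eq ?_)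
    field_simp
    ring
  have htG : t / (1 - Real.cos a + (1 - Real.cos b)) ^ 2 ≤ t / G ^ 2 := by
    apply div_le_div_of_nonneg_left ht0 (by positivity)
    apply pow_le_pow_left₀ hGpos.le
    linarith
  have hlin : logPot ε (a + θ) b + logPot ε (a - θ) b + logPot ε a (b + θ) + logPot ε a (b - θ)
      - 4 * logPot ε a b = (Real.log P1 + Real.log P2 + Real.log P3 + Real.log P4 - 4 * Real.log G)
        + 4 * ε * (-((2 - (1 - Real.cos a + (1 - Real.cos b))) / 16)
          + (1 - (1 - Real.cos a)) * (1 - (1 - Real.cos b)) / 16) := by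
    unfold logPot
    rw [e3, e4]
    have hca : Real.cos (a + θ) = 2 * Real.cos a * (1 - ε) - Real.cos (a - θ) := by linarith
    have hcb : Real.cos (b + θ) = 2 * Real.cos b * (1 - ε) - Real.cos (b - θ) := by linarith
    rw [← hP1, ← hP2, ← hG, hca, hcb]
    ring
  have hfin : 4 * ε * (-((2 - (1 - Real.cos a + (1 - Real.cos b))) / 16)
      + (1 - (1 - Real.cos a)) * (1 - (1 - Real.cos b)) / 16 - t / G ^ 2)
      ≤ 4 * ε * (-(1 / 16)) := by
    refine mul_le_mul_of_nonneg_left ?_ (by linarith)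
    linarith
  have hε2 : ε ^ 2 ≤ ε / 500 := by
    rw [pow_two]
    linarith [mul_le_mul_of_nonneg_left hε1 hε0]
  linarith

/-! ### Angles, distances and circles on the torus. -/

@[simp] lemma unitStep_zero : unitStep n 0 = (1, 0) := rfl
@[simp] lemma unitStep_one : unitStep n 1 = (-1, 0) := rfl
@[simp] lemma unitStep_two : unitStep n 2 = (0, 1) := rfl
@[simp] lemma unitStep_three : unitStep n 3 = (0, -1) := rfl

lemma exists_neg_unitStep (j : Fin 4) : ∃ i, unitStep n i = -unitStep n j := by
  fin_cases j
  · exact ⟨1, by simp⟩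
  · exact ⟨0, by simp⟩
  · exact ⟨3, by simp⟩
  · exact ⟨2, by simp⟩

/-- The angle `2πa/n` of a residue `a` modulo `n`. -/
def ang (a : ZMod n) : ℝ := 2 * Real.pi * (a.valMinAbs : ℝ) / n

/-- The angle of the least representative may jump by a multiple of 2π under translation; its cosine
does not see the jump. -/
lemma cos_ang_add [NeZero n] (a : ZMod n) (m : ℤ) (φ : ℝ) :
    Real.cos (ang (a + (m : ZMod n)) + φ) = Real.cos (ang a + φ + m * (2 * Real.pi / n)) := by
  have hn : (n : ℝ) ≠ 0 := Nat.cast_ne_zero.2 (NeZero.ne n)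
  have h : (n : ℤ) ∣ (a + m).valMinAbs - (a.valMinAbs + m) := by
    rw [← ZMod.intCast_zmod_eq_zero_iff_dvd]
    push_cast
    simp
  obtain ⟨k, hk⟩ := h
  have hk' : ((a + m).valMinAbs : ℝ) = a.valMinAbs + m + n * k := by
    have : (a + m).valMinAbs = a.valMinAbs + m + n * k := by linarith
    rw [this]; push_cast; ring
  have : ang (a + (m : ZMod n)) + φ = ang a + φ + m * (2 * Real.pi / n) + k * (2 * Real.pi) := by
    unfold ang
    rw [hk']
    field_simp
    ring
  rw [this, Real.cos_add_int_mul_two_pi]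

lemma dist2_nonneg (x y : Torus n) : 0 ≤ dist2 x y := Real.sqrt_nonneg _

lemma dist2_sq (x y : Torus n) :
    dist2 x y ^ 2 = ((x.1 - y.1).valMinAbs : ℝ) ^ 2 + ((x.2 - y.2).valMinAbs : ℝ) ^ 2 :=
  Real.sq_sqrt (by positivity)

lemma abs_ang_le [NeZero n] (a : ZMod n) : |ang a| ≤ Real.pi := by
  have hn : (0 : ℝ) < n := Nat.cast_pos.2 (Nat.pos_of_ne_zero (NeZero.ne n))
  have h := a.valMinAbs_mem_Ioc
  have h1 : -(n : ℝ) < a.valMinAbs * 2 := by exact_mod_cast h.1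
  have h2 : (a.valMinAbs : ℝ) * 2 ≤ n := by exact_mod_cast h.2
  have : |(a.valMinAbs : ℝ) * 2 / n| ≤ 1 := by
    rw [abs_div, abs_of_pos hn, div_le_one hn, abs_le]
    exact ⟨h1.le, h2⟩
  have he : ang a = Real.pi * ((a.valMinAbs : ℝ) * 2 / n) := by unfold ang; ring
  rw [he, abs_mul, abs_of_pos Real.pi_pos]
  nlinarith [Real.pi_pos]

lemma ang_sq_add (w : Torus n) : ang w.1 ^ 2 + ang w.2 ^ 2
    = (2 * Real.pi / n) ^ 2 * ((w.1.valMinAbs : ℝ) ^ 2 + (w.2.valMinAbs : ℝ) ^ 2) := by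
  unfold ang; ring

lemma le_two_sub_cos [NeZero n] (y x : Torus n) :
    8 * dist2 y x ^ 2 / (n : ℝ) ^ 2 ≤ 2 - Real.cos (ang (y.1 - x.1)) - Real.cos (ang (y.2 - x.2)) := by
  have h1 := Real.cos_le_one_sub_mul_cos_sq (abs_ang_le (y.1 - x.1))
  have h2 := Real.cos_le_one_sub_mul_cos_sq (abs_ang_le (y.2 - x.2))
  have h3 := ang_sq_add (y - x)
  rw [Prod.fst_sub, Prod.snd_sub, ← dist2_sq] at h3
  have hn : (n : ℝ) ≠ 0 := Nat.cast_ne_zero.2 (NeZero.ne n)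
  have h4 : 8 * dist2 y x ^ 2 / (n : ℝ) ^ 2
      = 2 / Real.pi ^ 2 * (ang (y.1 - x.1) ^ 2 + ang (y.2 - x.2) ^ 2) := by
    rw [h3]
    field_simp
    ring
  rw [h4]
  linarith

/-- The smaller of the two squares is at most π²/2, which keeps that cosine away from −1. For balls
of radius below n/2 this keeps the antipode of the centre at a definite distance. -/
lemma quarter_le_two_add_cos_of_sq_le {a b : ℝ} (h : a ^ 2 + b ^ 2 ≤ Real.pi ^ 2) :
    1 / 4 ≤ 2 + Real.cos a + Real.cos b := by
  wlog hab : a ^ 2 ≤ b ^ 2 generalizing a b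
  · have := this (a := b) (b := a) (by linarith) (by linarith)
    linarith
  have hpi : Real.pi ^ 2 ≤ 9.88 := by nlinarith [Real.pi_lt_d4, Real.pi_pos]
  have h1 := Real.one_sub_sq_div_two_le_cos (x := a / 2)
  have h2 : 0.38 ≤ Real.cos (a / 2) := by nlinarith
  have h3 : Real.cos a = 2 * Real.cos (a / 2) ^ 2 - 1 := by
    rw [← Real.cos_two_mul]; congr 1; ring
  nlinarith [Real.neg_one_le_cos b]

lemma quarter_le_two_add_cos [NeZero n] {y x : Torus n} (h : dist2 y x < n / 2) :
    1 / 4 ≤ 2 + Real.cos (ang (y.1 - x.1)) + Real.cos (ang (y.2 - x.2)) := by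
  apply quarter_le_two_add_cos_of_sq_le
  have h3 := ang_sq_add (y - x)
  rw [Prod.fst_sub, Prod.snd_sub, ← dist2_sq] at h3
  rw [h3]
  have hn : (0 : ℝ) < n := Nat.cast_pos.2 (Nat.pos_of_ne_zero (NeZero.ne n))
  have h4 : dist2 y x ^ 2 ≤ (n / 2) ^ 2 := pow_le_pow_left₀ (dist2_nonneg _ _) h.le 2
  calc (2 * Real.pi / n) ^ 2 * dist2 y x ^ 2 ≤ (2 * Real.pi / n) ^ 2 * (n / 2) ^ 2 :=
        mul_le_mul_of_nonneg_left h4 (sq_nonneg _)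
    _ = Real.pi ^ 2 := by field_simp

lemma dist2_add_unitStep_le (y x : Torus n) [NeZero n] (j : Fin 4) :
    dist2 y (x + unitStep n j) ≤ dist2 y x + 1 := by
  have hone : ∀ a c : ZMod n, (c = 1 ∨ c = -1) →
      |((a - c).valMinAbs : ℝ)| ≤ |(a.valMinAbs : ℝ)| + 1 := by
    intro a c hc
    have h1 : c.valMinAbs.natAbs ≤ 1 := by
      have h0 : (1 : ZMod n).valMinAbs.natAbs ≤ 1 := by
        rw [ZMod.valMinAbs_natAbs_eq_min]
        refine (min_le_left _ _).trans ?_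
        rw [ZMod.val_one_eq_one_mod]
        exact Nat.mod_le _ _
      rcases hc with rfl | rfl
      · exact h0
      · rwa [ZMod.natAbs_valMinAbs_neg]
    have h2 := ZMod.natAbs_valMinAbs_add_le a (-c)
    have h3 : (-c).valMinAbs.natAbs ≤ 1 := by rwa [ZMod.natAbs_valMinAbs_neg]
    have h4 : (a - c).valMinAbs.natAbs ≤ a.valMinAbs.natAbs + 1 := by
      rw [sub_eq_add_neg]
      exact h2.trans ((Int.natAbs_add_le _ _).trans (by omega))
    have h5 : |(a - c).valMinAbs| ≤ |a.valMinAbs| + 1 := by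
      rw [Int.abs_eq_natAbs, Int.abs_eq_natAbs]
      exact_mod_cast h4
    exact_mod_cast h5
  have key : ∀ p q p' : ℝ, |p'| ≤ |p| + 1 →
      Real.sqrt (p' ^ 2 + q ^ 2) ≤ Real.sqrt (p ^ 2 + q ^ 2) + 1 := by
    intro p q p' h
    have hs := Real.sqrt_nonneg (p ^ 2 + q ^ 2)
    have hs2 := Real.sq_sqrt (show 0 ≤ p ^ 2 + q ^ 2 by positivity)
    have hp : |p| ≤ Real.sqrt (p ^ 2 + q ^ 2) := by
      apply Real.abs_le_sqrt
      nlinarith [sq_nonneg q]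
    refine Real.sqrt_le_iff.2 ⟨by linarith, ?_⟩
    have : p' ^ 2 ≤ (|p| + 1) ^ 2 := sq_le_sq' (by linarith [neg_abs_le p']) ((le_abs_self _).trans h)
    nlinarith [sq_abs p]
  unfold dist2
  fin_cases j
  · simpa [← sub_sub] using key _ _ _ (hone (y.1 - x.1) 1 (Or.inl rfl))
  · simpa [← sub_sub] using key _ _ _ (hone (y.1 - x.1) (-1) (Or.inr rfl))
  · have := key _ ((y.1 - x.1).valMinAbs : ℝ) _ (hone (y.2 - x.2) 1 (Or.inl rfl))
    simpa [← sub_sub, add_comm] using this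
  · have := key _ ((y.1 - x.1).valMinAbs : ℝ) _ (hone (y.2 - x.2) (-1) (Or.inr rfl))
    simpa [← sub_sub, add_comm] using this

lemma valMinAbs_one_of_two_lt [NeZero n] (hn : 2 < n) : (1 : ZMod n).valMinAbs = 1 := by
  rw [ZMod.valMinAbs_spec]
  exact ⟨by simp, by constructor <;> omega⟩

lemma valMinAbs_neg_one_of_two_lt [NeZero n] (hn : 2 < n) : (-1 : ZMod n).valMinAbs = -1 := by
  rw [ZMod.valMinAbs_spec]
  exact ⟨by simp, by constructor <;> omega⟩

lemma dist2_eq_one_iff [NeZero n] (hn : 2 < n) {x z : Torus n} :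
    dist2 x z = 1 ↔ ∃ j, z + unitStep n j = x := by
  constructor
  · intro h
    have h2 := dist2_sq x z
    rw [h] at h2
    have h3 : (x.1 - z.1).valMinAbs ^ 2 + (x.2 - z.2).valMinAbs ^ 2 = 1 := by
      have : (((x.1 - z.1).valMinAbs ^ 2 + (x.2 - z.2).valMinAbs ^ 2 : ℤ) : ℝ) = 1 := by
        push_cast; linarith
      exact_mod_cast this
    have c1 := ZMod.coe_valMinAbs (x.1 - z.1)
    have c2 := ZMod.coe_valMinAbs (x.2 - z.2)
    set a := (x.1 - z.1).valMinAbs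
    set b := (x.2 - z.2).valMinAbs
    have ha : a ≤ 1 := by nlinarith [sq_nonneg b]
    have ha' : -1 ≤ a := by nlinarith [sq_nonneg b]
    have hb : b ≤ 1 := by nlinarith [sq_nonneg a]
    have hb' : -1 ≤ b := by nlinarith [sq_nonneg a]
    have hcases : (a = 1 ∧ b = 0) ∨ (a = -1 ∧ b = 0) ∨ (a = 0 ∧ b = 1) ∨ (a = 0 ∧ b = -1) := by
      interval_cases a <;> interval_cases b <;> simp_all
    have hx1 : x.1 = z.1 + (a : ZMod n) := by rw [c1]; ring
    have hx2 : x.2 = z.2 + (b : ZMod n) := by rw [c2]; ring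
    rcases hcases with ⟨h1, h2⟩ | ⟨h1, h2⟩ | ⟨h1, h2⟩ | ⟨h1, h2⟩ <;> rw [h1] at hx1 <;>
      rw [h2] at hx2
    · exact ⟨0, Prod.ext (by simp [hx1]) (by simp [hx2])⟩
    · exact ⟨1, Prod.ext (by simp [hx1]) (by simp [hx2])⟩
    · exact ⟨2, Prod.ext (by simp [hx1]) (by simp [hx2])⟩
    · exact ⟨3, Prod.ext (by simp [hx1]) (by simp [hx2])⟩
  · rintro ⟨j, rfl⟩
    unfold dist2
    fin_cases j <;>
      simp [valMinAbs_one_of_two_lt hn, valMinAbs_neg_one_of_two_lt hn]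

lemma dist2_self (y : Torus n) : dist2 y y = 0 := by
  simp [dist2]

lemma ball_nontrivial [NeZero n] (hn : 2 < n) {y : Torus n} {r : ℝ} (hr : 1 < r) :
    (ball y r).Nontrivial := by
  refine ⟨y, ?_, y + unitStep n 0, ?_, ?_⟩
  · simp only [ball, Set.mem_ofPred_eq, dist2_self]; linarith
  · have := dist2_add_unitStep_le y y 0
    rw [dist2_self] at this
    simp only [ball, Set.mem_ofPred_eq]; linarith
  · intro h
    have h1 : (unitStep n 0).1 = (0 : Torus n).1 := by
      rw [← left_eq_add.1 h]
    have h2 := valMinAbs_one_of_two_lt hn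
    simp only [unitStep_zero, Prod.fst_zero] at h1
    rw [h1, ZMod.valMinAbs_zero] at h2
    omega

lemma mem_circle_iff [NeZero n] (hn : 2 < n) {y z : Torus n} {r : ℝ} (hr : 1 < r) :
    z ∈ circle y r ↔ r ≤ dist2 y z ∧ ∃ j, dist2 y (z + unitStep n j) < r := by
  have hnt := ball_nontrivial hn (y := y) hr
  simp only [circle, bdry, Set.mem_ofPred_eq]
  constructor
  · rintro (h | ⟨_, h1, x, hx, hxz⟩)
    · rw [h] at hnt
      exact absurd hnt Set.not_nontrivial_singleton
    · obtain ⟨j, rfl⟩ := (dist2_eq_one_iff hn).1 hxz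
      exact ⟨by simpa [ball] using h1, j, hx⟩
  · rintro ⟨h1, j, hj⟩
    exact Or.inr ⟨hnt, by simpa [ball] using h1, _, hj, (dist2_eq_one_iff hn).2 ⟨j, rfl⟩⟩

/-- Some neighbour lies in the ball. This separates the two circles and places the inner circle
inside the outer ball. -/
lemma dist2_lt_of_mem_circle [NeZero n] (hn : 2 < n) {y z : Torus n} {r : ℝ} (hr : 1 < r)
    (h : z ∈ circle y r) : dist2 y z < r + 1 := by
  obtain ⟨_, j, hj⟩ := (mem_circle_iff hn hr).1 h
  obtain ⟨i, hi⟩ := exists_neg_unitStep (n := n) j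
  have := dist2_add_unitStep_le y (z + unitStep n j) i
  rw [hi, add_neg_cancel_right] at this
  linarith

/-- Off the circle, a step does not change the side. -/
lemma step_of_mem_ball [NeZero n] (hn : 2 < n) {y x : Torus n} {r : ℝ} (hr : 1 < r)
    (h : dist2 y x < r) (j : Fin 4) :
    dist2 y (x + unitStep n j) < r ∨ x + unitStep n j ∈ circle y r := by
  by_cases h' : dist2 y (x + unitStep n j) < r
  · exact Or.inl h'
  · obtain ⟨i, hi⟩ := exists_neg_unitStep (n := n) j
    refine Or.inr ((mem_circle_iff hn hr).2 ⟨not_lt.1 h', i, ?_⟩)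
    rwa [hi, add_neg_cancel_right]

lemma step_of_notMem_ball [NeZero n] (hn : 2 < n) {y x : Torus n} {r : ℝ} (hr : 1 < r)
    (h : r ≤ dist2 y x) (hx : x ∉ circle y r) (j : Fin 4) :
    r ≤ dist2 y (x + unitStep n j) := by
  by_contra h'
  exact hx ((mem_circle_iff hn hr).2 ⟨h, j, not_le.1 h'⟩)

/-- From a point other than `y` some step leads closer to `y`. -/
lemma exists_step_closer [NeZero n] {y x : Torus n} (h : x ≠ y) :
    ∃ j, dist2 y (x + unitStep n j) < dist2 y x := by
  have hdown : ∀ a : ZMod n, 0 < a.valMinAbs → (a - 1).valMinAbs = a.valMinAbs - 1 := by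
    intro a ha
    have := a.valMinAbs_mem_Ioc
    rw [ZMod.valMinAbs_spec]
    refine ⟨by simp, ?_, ?_⟩ <;> linarith [this.1, this.2]
  have hup : ∀ a : ZMod n, a.valMinAbs < 0 → (a + 1).valMinAbs = a.valMinAbs + 1 := by
    intro a ha
    have := a.valMinAbs_mem_Ioc
    rw [ZMod.valMinAbs_spec]
    refine ⟨by simp, ?_, ?_⟩ <;> linarith [this.1, this.2]
  have hcast : ∀ a : ℤ, 0 < a → (((a - 1 : ℤ) : ℝ)) ^ 2 < (a : ℝ) ^ 2 := by
    intro a ha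
    have : (1 : ℝ) ≤ a := by exact_mod_cast ha
    push_cast
    nlinarith
  have hcast' : ∀ a : ℤ, a < 0 → (((a + 1 : ℤ) : ℝ)) ^ 2 < (a : ℝ) ^ 2 := by
    intro a ha
    have : (a : ℝ) ≤ -1 := by exact_mod_cast Int.le_sub_one_of_lt ha
    push_cast
    nlinarith
  unfold dist2
  rcases lt_trichotomy (y.1 - x.1).valMinAbs 0 with h1 | h1 | h1
  · refine ⟨1, Real.sqrt_lt_sqrt (by positivity) ?_⟩
    have e : y.1 - (x + unitStep n 1).1 = y.1 - x.1 + 1 := by simp; ring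
    have e2 : y.2 - (x + unitStep n 1).2 = y.2 - x.2 := by simp
    rw [e, e2, hup _ h1]
    linarith [hcast' _ h1]
  · rcases lt_trichotomy (y.2 - x.2).valMinAbs 0 with h2 | h2 | h2
    · refine ⟨3, Real.sqrt_lt_sqrt (by positivity) ?_⟩
      have e : y.2 - (x + unitStep n 3).2 = y.2 - x.2 + 1 := by simp; ring
      have e2 : y.1 - (x + unitStep n 3).1 = y.1 - x.1 := by simp
      rw [e, e2, hup _ h2]
      linarith [hcast' _ h2]
    · rw [ZMod.valMinAbs_eq_zero] at h1 h2
      exact absurd (Prod.ext (sub_eq_zero.1 h1).symm (sub_eq_zero.1 h2).symm) h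
    · refine ⟨2, Real.sqrt_lt_sqrt (by positivity) ?_⟩
      have e : y.2 - (x + unitStep n 2).2 = y.2 - x.2 - 1 := by simp; ring
      have e2 : y.1 - (x + unitStep n 2).1 = y.1 - x.1 := by simp
      rw [e, e2, hdown _ h2]
      linarith [hcast _ h2]
  · refine ⟨0, Real.sqrt_lt_sqrt (by positivity) ?_⟩
    have e : y.1 - (x + unitStep n 0).1 = y.1 - x.1 - 1 := by simp; ring
    have e2 : y.2 - (x + unitStep n 0).2 = y.2 - x.2 := by simp
    rw [e, e2, hdown _ h1]
    linarith [hcast _ h1]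

/-! ### Hitting times of circles on the torus. -/

/-- `logPot` at the point `x` of the torus seen from `y`, with both angles shifted by `φ`. -/
def torusPot (φ ε : ℝ) (y x : Torus n) : ℝ :=
  logPot ε (ang (y.1 - x.1) + φ) (ang (y.2 - x.2) + φ)

/-- The potential depends on the angles only through their cosines, so a step on the torus acts as a
shift by ±2π/n, wrap-around included, and `logPot_drift` applies. -/
lemma sum_torusPot_step [NeZero n] (φ ε : ℝ) (y x : Torus n) :
    ∑ j : Fin 4, torusPot φ ε y (x + unitStep n j)
      = logPot ε (ang (y.1 - x.1) + φ + 2 * Real.pi / n) (ang (y.2 - x.2) + φ)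
        + logPot ε (ang (y.1 - x.1) + φ - 2 * Real.pi / n) (ang (y.2 - x.2) + φ)
        + logPot ε (ang (y.1 - x.1) + φ) (ang (y.2 - x.2) + φ + 2 * Real.pi / n)
        + logPot ε (ang (y.1 - x.1) + φ) (ang (y.2 - x.2) + φ - 2 * Real.pi / n) := by
  have hm : ∀ a : ZMod n, Real.cos (ang (a - 1) + φ) = Real.cos (ang a + φ - 2 * Real.pi / n) := by
    intro a
    have := cos_ang_add a (-1) φ
    push_cast at this
    rw [sub_eq_add_neg, this]
    congr 1
    ring
  have hp : ∀ a : ZMod n, Real.cos (ang (a + 1) + φ) = Real.cos (ang a + φ + 2 * Real.pi / n) := by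
    intro a
    have := cos_ang_add a 1 φ
    push_cast at this
    rw [this]
    congr 1
    ring
  simp only [Fin.sum_univ_four, torusPot, logPot, unitStep_zero, unitStep_one, unitStep_two,
    unitStep_three, Prod.fst_add, Prod.snd_add, add_zero]
  have e1 : ∀ a b : ZMod n, a - (b + 1) = a - b - 1 := fun a b => by ring
  have e2 : ∀ a b : ZMod n, a - (b + -1) = a - b + 1 := fun a b => by ring
  simp only [e1, e2, hm, hp]
  ring

lemma one_sub_cos_bounds {N : ℝ} (hN : 2 ≤ N) :
    8 / N ^ 2 ≤ 1 - Real.cos (2 * Real.pi / N) ∧ 1 - Real.cos (2 * Real.pi / N) ≤ 20 / N ^ 2 := by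
  have hpi := Real.pi_pos
  have hN0 : 0 < N := by linarith
  constructor
  · have h : |2 * Real.pi / N| ≤ Real.pi := by
      rw [abs_of_pos (by positivity), div_le_iff₀ hN0]
      nlinarith
    have := Real.cos_le_one_sub_mul_cos_sq h
    have e : 2 / Real.pi ^ 2 * (2 * Real.pi / N) ^ 2 = 8 / N ^ 2 := by field_simp; norm_num
    linarith
  · have := Real.one_sub_sq_div_two_le_cos (x := 2 * Real.pi / N)
    have e : (2 * Real.pi / N) ^ 2 / 2 = 2 * Real.pi ^ 2 / N ^ 2 := by field_simp
    have hpi2 : 2 * Real.pi ^ 2 ≤ 20 := by nlinarith [Real.pi_lt_d4]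
    have := div_le_div_of_nonneg_right hpi2 (show 0 ≤ N ^ 2 by positivity)
    linarith

lemma logPot_le {ε a b : ℝ} (hε0 : 0 ≤ ε) (h : 0 < 2 - Real.cos a - Real.cos b - 2 * ε) :
    logPot ε a b ≤ 3 := by
  have h1 : Real.log (2 - Real.cos a - Real.cos b - 2 * ε)
      ≤ Real.log 4 := by
    apply Real.log_le_log h
    linarith [Real.neg_one_le_cos a, Real.neg_one_le_cos b]
  have h4 : Real.log 4 ≤ 1.4 := by
    rw [show (4 : ℝ) = 2 ^ 2 by norm_num, Real.log_pow]
    push_cast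
    linarith [Real.log_two_lt_d9]
  have := Real.neg_one_le_cos a
  have := Real.neg_one_le_cos b
  have := Real.cos_le_one a
  have := Real.cos_le_one b
  unfold logPot
  nlinarith

lemma log_sub_one_le_logPot {ε a b : ℝ} : Real.log (2 - Real.cos a - Real.cos b - 2 * ε) - 1
    ≤ logPot ε a b := by
  have := Real.neg_one_le_cos a
  have := Real.neg_one_le_cos b
  have := Real.cos_le_one a
  have := Real.cos_le_one b
  unfold logPot
  nlinarith

lemma log_two_le_log_div {N ρ : ℝ} (hρ : 0 < ρ) (h : ρ < N / 2) : 0.69 ≤ Real.log (N / ρ) := by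
  have : Real.log 2 ≤ Real.log (N / ρ) := by
    apply Real.log_le_log (by norm_num)
    rw [le_div_iff₀ hρ]
    linarith
  linarith [Real.log_two_gt_d9]

/-- The hitting time of a circle of radius `ρ` lives on the scale `n² log (n/ρ)`. -/
lemma hasExpBound_hit_circle [NeZero n] {y : Torus n} {ρ : ℝ} (hρ : 100 ≤ ρ)
    (hn : ρ < (n : ℝ) / 2) :
    HasExpBound (hit (circle y ρ)) (50 * ((n : ℝ) ^ 2 * Real.log (n / ρ))) 2 := by
  classical
  have hN : (200 : ℝ) < n := by linarith
  have hn2 : 2 < n := by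
    have : (2 : ℝ) < n := by linarith
    exact_mod_cast this
  have hn0 : (0 : ℝ) < n := by linarith
  have hρ0 : 0 < ρ := by linarith
  have hρ1 : 1 < ρ := by linarith
  have hlog := log_two_le_log_div hρ0 hn
  set l := Real.log (n / ρ) with hl
  obtain ⟨hε8, hε20⟩ := one_sub_cos_bounds (N := n) (by linarith)
  set ε := 1 - Real.cos (2 * Real.pi / n) with hε
  have hN2 : (40000 : ℝ) < (n : ℝ) ^ 2 := by nlinarith
  have hN2p : (0 : ℝ) < (n : ℝ) ^ 2 := by linarith
  have hεsmall : ε ≤ 1 / 2000 := by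
    refine hε20.trans ?_
    rw [div_le_div_iff₀ hN2p (by norm_num)]
    linarith
  have hε0 : 0 ≤ ε := (by positivity : (0 : ℝ) ≤ 8 / (n : ℝ) ^ 2).trans hε8
  have hN2ε : 8 ≤ (n : ℝ) ^ 2 * ε := by
    rw [div_le_iff₀ hN2p] at hε8
    linarith
  have hout : ∀ x : Torus n, ρ ≤ dist2 y x →
      4 * ρ ^ 2 / (n : ℝ) ^ 2
        ≤ 2 - Real.cos (ang (y.1 - x.1)) - Real.cos (ang (y.2 - x.2)) - 2 * ε ∧
      100 * ε ≤ 2 - Real.cos (ang (y.1 - x.1)) - Real.cos (ang (y.2 - x.2)) := by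
    intro x hx
    have h1 := le_two_sub_cos y x
    have h2 : 8 * ρ ^ 2 / (n : ℝ) ^ 2 ≤ 8 * dist2 y x ^ 2 / (n : ℝ) ^ 2 := by
      apply div_le_div_of_nonneg_right _ hN2p.le
      nlinarith [pow_le_pow_left₀ hρ0.le hx 2]
    have h3 : 100 * ε ≤ 8 * ρ ^ 2 / (n : ℝ) ^ 2 := by
      have : 100 * (20 / (n : ℝ) ^ 2) ≤ 8 * ρ ^ 2 / (n : ℝ) ^ 2 := by
        rw [← mul_div_assoc]
        apply div_le_div_of_nonneg_right _ hN2p.le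
        nlinarith
      linarith
    have h4 : 4 * ρ ^ 2 / (n : ℝ) ^ 2 = (8 * ρ ^ 2 / (n : ℝ) ^ 2) / 2 := by ring
    constructor <;> linarith
  have hin : ∀ x : Torus n, dist2 y x < ρ →
      1 / 4 ≤ 2 - Real.cos (ang (y.1 - x.1) + Real.pi) - Real.cos (ang (y.2 - x.2) + Real.pi) := by
    intro x hx
    rw [Real.cos_add_pi, Real.cos_add_pi]
    linarith [quarter_le_two_add_cos (hx.trans hn)]
  have hstep : ∀ (x : Torus n) (j : Fin 4),
      |Real.cos (ang (y.1 - (x + unitStep n j).1) + Real.pi) +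
        Real.cos (ang (y.2 - (x + unitStep n j).2) + Real.pi) -
        (Real.cos (ang (y.1 - x.1) + Real.pi) + Real.cos (ang (y.2 - x.2) + Real.pi))|
        ≤ 2 * Real.pi / n := by
    intro x j
    have hone : ∀ (a : ZMod n) (m : ℤ), |(m : ℝ)| = 1 →
        |Real.cos (ang (a + (m : ZMod n)) + Real.pi) - Real.cos (ang a + Real.pi)| ≤ 2 * Real.pi / n := by
      intro a m hm
      rw [cos_ang_add]
      refine (Real.abs_cos_sub_cos_le _ _).trans ?_
      rw [add_sub_cancel_left, abs_mul, hm, one_mul, abs_of_pos (by positivity)]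
    have h1 : ∀ a : ZMod n, |Real.cos (ang (a - 1) + Real.pi) - Real.cos (ang a + Real.pi)|
        ≤ 2 * Real.pi / n := by
      intro a
      simpa [sub_eq_add_neg] using hone a (-1) (by simp)
    have h2 : ∀ a : ZMod n, |Real.cos (ang (a + 1) + Real.pi) - Real.cos (ang a + Real.pi)|
        ≤ 2 * Real.pi / n := by
      intro a
      simpa using hone a 1 (by simp)
    have e1 : ∀ a b : ZMod n, a - (b + 1) = a - b - 1 := fun a b => by ring
    have e2 : ∀ a b : ZMod n, a - (b + -1) = a - b + 1 := fun a b => by ring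
    fin_cases j
    · simp only [Fin.zero_eta, unitStep_zero, Prod.fst_add, Prod.snd_add, add_zero, e1,
        add_sub_add_right_eq_sub]
      exact h1 _
    · simp only [Fin.mk_one, unitStep_one, Prod.fst_add, Prod.snd_add, add_zero, e2,
        add_sub_add_right_eq_sub]
      exact h2 _
    · simp only [Fin.reduceFinMk, unitStep_two, Prod.fst_add, Prod.snd_add, add_zero, e1,
        add_sub_add_left_eq_sub]
      exact h1 _
    · simp only [Fin.reduceFinMk, unitStep_three, Prod.fst_add, Prod.snd_add, add_zero, e2,
        add_sub_add_left_eq_sub]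
      exact h2 _
  have hθ : 2 * Real.pi / n ≤ 1 / 16 := by
    rw [div_le_iff₀ hn0]
    linarith [Real.pi_lt_d2]
  have hpotout0 : ∀ x : Torus n, ρ ≤ dist2 y x → 0 ≤ torusPot 0 ε y x + (2 * l + 1) := by
    intro x hx
    have h1 := (hout x hx).1
    have h2 : -(2 * l) ≤ Real.log (2 - Real.cos (ang (y.1 - x.1) + 0)
        - Real.cos (ang (y.2 - x.2) + 0) - 2 * ε) := by
      rw [add_zero, add_zero]
      have h3 : -(2 * l) = Real.log (ρ ^ 2 / (n : ℝ) ^ 2) := by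
        rw [hl, ← div_pow, Real.log_pow, Real.log_div hn0.ne' hρ0.ne',
          Real.log_div hρ0.ne' hn0.ne']
        push_cast
        ring
      rw [h3]
      apply Real.log_le_log (by positivity)
      refine le_trans ?_ h1
      apply div_le_div_of_nonneg_right _ hN2p.le
      nlinarith
    have h4 := log_sub_one_le_logPot (ε := ε) (a := ang (y.1 - x.1) + 0) (b := ang (y.2 - x.2) + 0)
    unfold torusPot
    linarith
  have hpotin0' : ∀ x : Torus n, 3 / 16 ≤ 2 - Real.cos (ang (y.1 - x.1) + Real.pi)
      - Real.cos (ang (y.2 - x.2) + Real.pi) → 0 ≤ torusPot Real.pi ε y x + 4 := by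
    intro x hx
    have h2 : -3 ≤ Real.log (2 - Real.cos (ang (y.1 - x.1) + Real.pi)
        - Real.cos (ang (y.2 - x.2) + Real.pi) - 2 * ε) := by
      have h3 : Real.log (1 / 8) ≤ Real.log (2 - Real.cos (ang (y.1 - x.1) + Real.pi)
        - Real.cos (ang (y.2 - x.2) + Real.pi) - 2 * ε) := by
        apply Real.log_le_log (by norm_num)
        linarith
      have h4 : Real.log (1 / 8) = -(3 * Real.log 2) := by
        rw [one_div, Real.log_inv, show (8 : ℝ) = 2 ^ 3 by norm_num, Real.log_pow]
        push_cast
        ring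
      linarith [Real.log_two_lt_d9]
    have h4 := log_sub_one_le_logPot (ε := ε) (a := ang (y.1 - x.1) + Real.pi)
      (b := ang (y.2 - x.2) + Real.pi)
    unfold torusPot
    linarith
  have hpotin0 : ∀ x : Torus n, dist2 y x < ρ → 0 ≤ torusPot Real.pi ε y x + 4 :=
    fun x hx => hpotin0' x (by linarith [hin x hx])
  -- The factor 4n² turns the drift −ε/8 into at most −4 for the sum over the four neighbours, as
  -- n²ε ≥ 8. The additive constants make f nonnegative, since log(ρ²/n²) = −2l outside. The scale
  -- 50 comes from 4·7 ≤ 50l and 4(2l + 4) ≤ 50l, both valid for l ≥ 0.69.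
  set f : Torus n → ℝ := fun x => if x ∈ circle y ρ then 0 else
    if dist2 y x < ρ then 4 * (n : ℝ) ^ 2 * (torusPot Real.pi ε y x + 4)
    else 4 * (n : ℝ) ^ 2 * (torusPot 0 ε y x + (2 * l + 1)) with hf
  have hΛ : 0 < 50 * ((n : ℝ) ^ 2 * l) := by
    have : 0 < l := by linarith
    positivity
  have hscale : ∀ t u : ℝ, t ≤ u → 4 * (n : ℝ) ^ 2 * t ≤ 4 * (n : ℝ) ^ 2 * u :=
    fun t u h => mul_le_mul_of_nonneg_left h (by positivity)
  refine hasExpBound_hit (f := f) hΛ ?_ ?_ ?_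
  · intro x
    simp only [hf]
    split_ifs with h1 h2
    · exact le_rfl
    · exact mul_nonneg (by positivity) (hpotin0 x h2)
    · exact mul_nonneg (by positivity) (hpotout0 x (not_lt.1 h2))
  · intro x
    simp only [hf]
    split_ifs with h1 h2
    · exact hΛ.le
    · have : torusPot Real.pi ε y x ≤ 3 := logPot_le hε0 (by linarith [hin x h2])
      refine (hscale _ 7 (by linarith)).trans ?_
      nlinarith
    · have h3 := (hout x (not_lt.1 h2)).1
      have h4 : 0 < 4 * ρ ^ 2 / (n : ℝ) ^ 2 := by positivity
      have : torusPot 0 ε y x ≤ 3 := by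
        refine logPot_le hε0 ?_
        rw [add_zero, add_zero]
        linarith
      refine (hscale _ (2 * l + 4) (by linarith)).trans ?_
      nlinarith
  · intro x hx
    by_cases hb : dist2 y x < ρ
    · have hle : ∀ j, f (x + unitStep n j)
          ≤ 4 * (n : ℝ) ^ 2 * (torusPot Real.pi ε y (x + unitStep n j) + 4) := by
        intro j
        simp only [hf]
        rcases step_of_mem_ball hn2 hρ1 hb j with h | h
        · have h' : x + unitStep n j ∉ circle y ρ := fun hc =>
            absurd h (not_lt.2 ((mem_circle_iff hn2 hρ1).1 hc).1)
          rw [if_neg h', if_pos h]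
        · rw [if_pos h]
          -- The new point lies outside the ball, but one step changes the sum of cosines by at most
          -- 2π/n ≤ 1/16, so the lower bound 1/4 drops no further than 3/16.
          refine mul_nonneg (by positivity) (hpotin0' _ ?_)
          have := (abs_le.1 (hstep x j)).2
          linarith [hin x hb]
      refine (Finset.sum_le_sum fun j _ => hle j).trans ?_
      rw [← Finset.mul_sum, Finset.sum_add_distrib, sum_torusPot_step]
      have hd := logPot_drift (a := ang (y.1 - x.1) + Real.pi) (b := ang (y.2 - x.2) + Real.pi)
        (θ := 2 * Real.pi / n) (ε := ε) rfl (by linarith) (by linarith [hin x hb])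
        (by linarith [hin x hb])
      have hfx : f x = 4 * (n : ℝ) ^ 2 * (torusPot Real.pi ε y x + 4) := by
        simp only [hf]
        rw [if_neg hx, if_pos hb]
      rw [hfx]
      simp only [Finset.sum_const, Finset.card_univ, Fintype.card_fin, nsmul_eq_mul]
      refine (hscale _ (4 * torusPot Real.pi ε y x - ε / 8 + 16) ?_).trans ?_
      · unfold torusPot
        push_cast
        linarith
      · nlinarith
    · have hb' := not_lt.1 hb
      have hout1 := hout x hb'
      have h4 : 0 < 4 * ρ ^ 2 / (n : ℝ) ^ 2 := by positivity
      have hle : ∀ j, f (x + unitStep n j)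
          ≤ 4 * (n : ℝ) ^ 2 * (torusPot 0 ε y (x + unitStep n j) + (2 * l + 1)) := by
        intro j
        have h := step_of_notMem_ball hn2 hρ1 hb' hx j
        simp only [hf]
        rw [if_neg (not_lt.2 h)]
        split_ifs
        · exact mul_nonneg (by positivity) (hpotout0 _ h)
        · exact le_rfl
      refine (Finset.sum_le_sum fun j _ => hle j).trans ?_
      rw [← Finset.mul_sum, Finset.sum_add_distrib, sum_torusPot_step]
      have hd := logPot_drift (a := ang (y.1 - x.1) + 0) (b := ang (y.2 - x.2) + 0)
        (θ := 2 * Real.pi / n) (ε := ε) rfl (by linarith)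
        (by rw [add_zero, add_zero]; linarith) (by rw [add_zero, add_zero]; linarith)
      have hfx : f x = 4 * (n : ℝ) ^ 2 * (torusPot 0 ε y x + (2 * l + 1)) := by
        simp only [hf]
        rw [if_neg hx, if_neg hb]
      rw [hfx]
      simp only [Finset.sum_const, Finset.card_univ, Fintype.card_fin, nsmul_eq_mul]
      refine (hscale _ (4 * torusPot 0 ε y x - ε / 8 + 4 * (2 * l + 1)) ?_).trans ?_
      · unfold torusPot
        push_cast
        linarith
      · nlinarith

/-! ### Excursions as iterated cycles. -/

lemma apply_mem_of_hitAfter_eq {A : Set (Torus n)} {t : ℕ∞} {s : ℕ → Torus n} {k : ℕ}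
    (h : hitAfter A t s = (k : ℕ∞)) : s k ∈ A :=
  (iInf_nat_eq_coe_iff.1 h).1.2

/-- The time of a visit to the inner circle followed by a visit to the outer one. -/
def cycleTime (y : Torus n) (R r : ℝ) : (ℕ → Torus n) → ℕ∞ :=
  seqTime (hit (circle y r)) (hit (circle y R))

lemma isStop_cycleTime (y : Torus n) (R r : ℝ) : IsStop (cycleTime y R r) :=
  (isStop_hit _).seqTime (isStop_hit _)

lemma excEnd_one {y : Torus n} {R r : ℝ} (hd : Disjoint (circle y r) (circle y R)) :
    excEnd y R r 1 = cycleTime y R r := by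
  funext s
  simp only [excEnd, excStart]
  rcases eq_or_ne (hit (circle y r) s) ⊤ with h | h
  · rw [h, hitAfter_top, cycleTime, seqTime_of_top h]
  · obtain ⟨k, hk⟩ := ENat.ne_top_iff_exists.1 h
    rw [cycleTime, seqTime_of_eq hk.symm, ← hk, hitAfter_eq_add_hit]
    exact Set.disjoint_left.1 hd (hit_eq_coe_iff.1 hk.symm).1

/-- Because the circles are disjoint, the path is off the next circle whenever it has just reached
one. "Strictly after" then agrees with the hitting time of the shifted path, and the strong Markov
property applies. -/
lemma excEnd_succ {y : Torus n} {R r : ℝ} (hd : Disjoint (circle y r) (circle y R)) (m : ℕ) :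
    excEnd y R r (m + 2) = seqTime (excEnd y R r (m + 1)) (cycleTime y R r) := by
  funext s
  have hstart : excStart y R r (m + 2) s
      = hitAfter (circle y r) (excEnd y R r (m + 1) s) s := rfl
  rw [excEnd, hstart]
  rcases eq_or_ne (excEnd y R r (m + 1) s) ⊤ with h | h
  · rw [seqTime_of_top h, h, hitAfter_top, hitAfter_top]
  · obtain ⟨k, hk⟩ := ENat.ne_top_iff_exists.1 h
    have hmem : s k ∉ circle y r := Set.disjoint_right.1 hd (apply_mem_of_hitAfter_eq hk.symm)
    rw [seqTime_of_eq hk.symm, ← hk, hitAfter_eq_add_hit hmem, cycleTime]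
    rcases eq_or_ne (hit (circle y r) (shift k s)) ⊤ with h' | h'
    · rw [h', seqTime_of_top h', add_top, hitAfter_top]
    · obtain ⟨l, hl⟩ := ENat.ne_top_iff_exists.1 h'
      have hl' : s (k + l) ∉ circle y R :=
        Set.disjoint_left.1 hd (hit_eq_coe_iff.1 hl.symm).1
      have hshift : shift l (shift k s) = shift (k + l) s := by
        funext i; simp [add_assoc]
      rw [seqTime_of_eq hl.symm, ← hl, ← Nat.cast_add, hitAfter_eq_add_hit hl', hshift,
        Nat.cast_add, add_assoc]

lemma isStop_excEnd {y : Torus n} {R r : ℝ} (hd : Disjoint (circle y r) (circle y R)) (m : ℕ) :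
    IsStop (excEnd y R r (m + 1)) := by
  induction m with
  | zero => rw [excEnd_one hd]; exact isStop_cycleTime _ _ _
  | succ m ih => rw [excEnd_succ hd]; exact ih.seqTime (isStop_cycleTime _ _ _)

lemma disjoint_circle [NeZero n] (hn : 2 < n) {y : Torus n} {R r : ℝ} (hr : 1 < r)
    (hR : r + 1 ≤ R) : Disjoint (circle y r) (circle y R) := by
  rw [Set.disjoint_left]
  intro z hz hz'
  have h1 := dist2_lt_of_mem_circle hn hr hz
  have h2 := ((mem_circle_iff hn (by linarith)).1 hz').1
  linarith

lemma HasExpBound.mono {τ : (ℕ → Torus n) → ℕ∞} {Λ Λ' C : ℝ} (h : HasExpBound τ Λ C)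
    (hΛ : 0 < Λ) (hle : Λ ≤ Λ') : HasExpBound τ Λ' C := by
  refine ⟨h.ae_ne_top, fun x => (stoppedExp_mono fun k _ => ?_).trans (h.exp_le x)⟩
  apply ENNReal.ofReal_le_ofReal
  apply Real.exp_le_exp.2
  exact div_le_div_of_nonneg_left (Nat.cast_nonneg k) (by linarith) (by linarith)

lemma prob_le_one (x : Torus n) (E : Set (ℕ → Torus n)) : prob x E ≤ 1 :=
  MeasureTheory.prob_le_one

/-! ### Kernels of the stopped walk. -/

/-- `P_x[S_τ = z]` as a real number. -/
def stopKernel (τ : (ℕ → Torus n) → ℕ∞) (x z : Torus n) : ℝ :=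
  (prob x {s | ∃ k : ℕ, τ s = (k : ℕ∞) ∧ s k = z}).toReal

lemma stopKernel_nonneg (τ : (ℕ → Torus n) → ℕ∞) (x z : Torus n) : 0 ≤ stopKernel τ x z :=
  ENNReal.toReal_nonneg

lemma ofReal_stopKernel {τ : (ℕ → Torus n) → ℕ∞} (x z : Torus n) :
    ENNReal.ofReal (stopKernel τ x z) = prob x {s | ∃ k : ℕ, τ s = (k : ℕ∞) ∧ s k = z} :=
  ENNReal.ofReal_toReal ((prob_le_one _ _).trans_lt ENNReal.one_lt_top).ne

lemma stopKernel_hit_of_notMem {A : Set (Torus n)} (x : Torus n) {z : Torus n} (hz : z ∉ A) :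
    stopKernel (hit A) x z = 0 := by
  have h : {s : ℕ → Torus n | ∃ k : ℕ, hit A s = (k : ℕ∞) ∧ s k = z} = ∅ := by
    ext s
    simp only [Set.mem_ofPred_eq, Set.mem_empty_iff_false, iff_false, not_exists, not_and]
    intro k hk hs
    exact hz (hs ▸ (hit_eq_coe_iff.1 hk).1)
  simp [stopKernel, h, prob]

lemma stoppedExp_eq_sum [NeZero n] {τ : (ℕ → Torus n) → ℕ∞} (hτ : IsStop τ) (x : Torus n)
    (c : Torus n → ℝ≥0∞) :
    stoppedExp x τ (fun _ z => c z) = ∑ z, ENNReal.ofReal (stopKernel τ x z) * c z := by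
  simp_rw [ofReal_stopKernel, prob_stopped_at hτ]
  unfold stoppedExp
  simp_rw [← lintegral_mul_const _ (hτ.measurable_stopped _ x)]
  rw [← lintegral_finsetSum _ fun z _ => (hτ.measurable_stopped _ x).mul_const _]
  refine lintegral_congr fun ω => ?_
  rcases eq_or_ne (τ (walk x ω)) ⊤ with h | h
  · simp [stopped_of_top h]
  · obtain ⟨k, hk⟩ := ENat.ne_top_iff_exists.1 h
    simp [stopped_of_eq hk.symm]

lemma HasExpBound.sum_stopKernel [NeZero n] {τ : (ℕ → Torus n) → ℕ∞} {Λ C : ℝ}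
    (h : HasExpBound τ Λ C) (hτ : IsStop τ) (x : Torus n) : ∑ z, stopKernel τ x z = 1 := by
  have h1 := stoppedExp_eq_sum hτ x fun _ => 1
  rw [h.stoppedExp_const] at h1
  simp_rw [mul_one] at h1
  rw [← ENNReal.ofReal_sum_of_nonneg fun z _ => stopKernel_nonneg _ _ _] at h1
  exact ENNReal.ofReal_eq_one.1 h1.symm

lemma stopKernel_seqTime [NeZero n] {τ σ : (ℕ → Torus n) → ℕ∞} (hτ : IsStop τ) (hσ : IsStop σ)
    (x z : Torus n) :
    stopKernel (seqTime τ σ) x z = ∑ w, stopKernel τ x w * stopKernel σ w z := by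
  have hnn : ∀ w, 0 ≤ stopKernel τ x w * stopKernel σ w z :=
    fun w => mul_nonneg (stopKernel_nonneg _ _ _) (stopKernel_nonneg _ _ _)
  rw [← ENNReal.ofReal_eq_ofReal_iff (stopKernel_nonneg _ _ _) (Finset.sum_nonneg fun w _ => hnn w),
    ofReal_stopKernel, prob_stopped_at (hτ.seqTime hσ), stoppedExp_seqTime hτ hσ,
    ENNReal.ofReal_sum_of_nonneg fun w _ => hnn w]
  simp_rw [ENNReal.ofReal_mul (stopKernel_nonneg _ _ _)]
  rw [stoppedExp_eq_sum hτ]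
  refine Finset.sum_congr rfl fun w _ => ?_
  rw [ofReal_stopKernel (τ := σ), prob_stopped_at hσ]

/-- A point of a circle is hit with positive probability from every point of the ball. -/
lemma prob_hitAt_circle_pos [NeZero n] (hn : 2 < n) {y u v : Torus n} {R : ℝ} (hR : 1 < R)
    (hu : u ∈ circle y R) (hv : dist2 y v < R) : 0 < stopKernel (hit (circle y R)) v u := by
  have hpos : ∀ x, 0 < stopKernel (hit (circle y R)) x u ↔ 0 < prob x (hitAt (circle y R) u) := by
    intro x
    rw [← ENNReal.ofReal_pos, ofReal_stopKernel]
    rfl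
  rw [hpos]
  have hstep : ∀ x, dist2 y x < R → ∀ j, 0 < prob (x + unitStep n j) (hitAt (circle y R) u) →
      0 < prob x (hitAt (circle y R) u) := by
    intro x hx j h
    have hxA : x ∉ circle y R := fun hc => absurd hx (not_lt.2 ((mem_circle_iff hn hR).1 hc).1)
    rw [prob_hitAt] at h
    rw [prob_hitAt, stoppedExp_hit_of_notMem hxA]
    refine lt_of_lt_of_le (ENNReal.mul_pos ?_ h.ne')
      (Finset.single_le_sum (f := fun j => (4 : ℝ≥0∞)⁻¹ * stoppedExp (x + unitStep n j)
        (hit (circle y R)) fun _ w => if w = u then 1 else 0) (fun _ _ => zero_le) (Finset.mem_univ j))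
    simp
  have hback : ∀ x j, dist2 y (x + unitStep n j) < R → 0 < prob x (hitAt (circle y R) u) →
      0 < prob (x + unitStep n j) (hitAt (circle y R) u) := by
    intro x j hx h
    obtain ⟨i, hi⟩ := exists_neg_unitStep (n := n) j
    refine hstep _ hx i ?_
    rwa [hi, add_neg_cancel_right]
  -- Positivity passes both ways across each step inside the ball, and distance-decreasing steps
  -- link every point of the ball to the centre; so it can be tested at a ball neighbour of `u`.
  have hcentre : ∀ x, dist2 y x < R →
      (0 < prob x (hitAt (circle y R) u) ↔ 0 < prob y (hitAt (circle y R) u)) := by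
    have : IsTrans (Torus n) fun a b => dist2 y a < dist2 y b := ⟨fun _ _ _ => lt_trans⟩
    have : Std.Irrefl fun a b : Torus n => dist2 y a < dist2 y b := ⟨fun _ => lt_irrefl _⟩
    have hwf : WellFounded fun a b : Torus n => dist2 y a < dist2 y b :=
      Finite.wellFounded_of_trans_of_irrefl _
    intro x
    induction x using hwf.induction with
    | _ x ih =>
      intro hx
      by_cases hxy : x = y
      · rw [hxy]
      · obtain ⟨j, hj⟩ := exists_step_closer hxy
        rw [← ih _ hj (hj.trans hx)]
        exact ⟨hback x j (hj.trans hx), hstep x hx j⟩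
  obtain ⟨_, j, hj⟩ := (mem_circle_iff hn hR).1 hu
  rw [hcentre v hv, ← hcentre _ hj]
  refine hback u j hj ?_
  rw [prob_hitAt, stoppedExp_hit_of_mem hu]
  simp

/-! ### Stationary distributions and Poisson's equation. -/

/-- A stochastic matrix has a stationary distribution. -/
lemma exists_stationary {ι : Type*} [Fintype ι] [Nonempty ι] (K : ι → ι → ℝ)
    (hK0 : ∀ i j, 0 ≤ K i j) (hK1 : ∀ i, ∑ j, K i j = 1) :
    ∃ ν : ι → ℝ, (∀ i, 0 ≤ ν i) ∧ ∑ i, ν i = 1 ∧ ∀ j, ∑ i, ν i * K i j = ν j := by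
  classical
  have hdet : (Matrix.of K - 1).det = 0 := by
    rw [← Matrix.exists_mulVec_eq_zero_iff]
    refine ⟨fun _ => 1, ?_, ?_⟩
    · obtain ⟨i⟩ := ‹Nonempty ι›
      exact fun h => one_ne_zero (congrFun h i)
    · funext i
      simp [Matrix.mulVec, dotProduct, hK1, Matrix.one_apply]
  obtain ⟨w, hw0, hw⟩ := Matrix.exists_vecMul_eq_zero_iff.2 hdet
  have hw' : ∀ j, ∑ i, w i * K i j = w j := by
    intro j
    have := congrFun hw j
    rw [Matrix.vecMul_sub, Matrix.vecMul_one] at this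
    simpa [Matrix.vecMul, dotProduct, sub_eq_zero] using this
  -- A left fixed vector may have signs, but |w| ≤ |w|K entrywise and both sides have the same total
  -- mass, so |w| is itself stationary.
  have hle : ∀ j, |w j| ≤ ∑ i, |w i| * K i j := by
    intro j
    rw [← hw' j]
    refine (Finset.abs_sum_le_sum_abs _ _).trans (le_of_eq ?_)
    refine Finset.sum_congr rfl fun i _ => ?_
    rw [abs_mul, abs_of_nonneg (hK0 i j)]
  have hsum : ∑ j, |w j| = ∑ j, ∑ i, |w i| * K i j := by
    rw [Finset.sum_comm]
    simp_rw [← Finset.mul_sum, hK1, mul_one]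
  have heq : ∀ j, |w j| = ∑ i, |w i| * K i j := fun j =>
    (Finset.sum_eq_sum_iff_of_le fun j _ => hle j).1 hsum j (Finset.mem_univ j)
  have hpos : 0 < ∑ i, |w i| := by
    obtain ⟨i, hi⟩ := Function.ne_iff.1 hw0
    exact Finset.sum_pos' (fun _ _ => abs_nonneg _) ⟨i, Finset.mem_univ i, abs_pos.2 hi⟩
  refine ⟨fun i => |w i| / ∑ i, |w i|, fun i => div_nonneg (abs_nonneg _) hpos.le, ?_, fun j => ?_⟩
  · rw [← Finset.sum_div, div_self hpos.ne']
  · simp_rw [div_mul_eq_mul_div, ← Finset.sum_div]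
    rw [← heq]

/-- The solution of Poisson's equation for a kernel that dominates `q` times its stationary
distribution. -/
lemma exists_poisson {ι : Type*} [Fintype ι] [Nonempty ι] {K : ι → ι → ℝ} {μ : ι → ℝ} {q B : ℝ}
    (hK1 : ∀ i, ∑ j, K i j = 1) (hμ1 : ∑ i, μ i = 1)
    (hμK : ∀ j, ∑ i, μ i * K i j = μ j) (hq : 0 < q) (hdom : ∀ i j, q * μ j ≤ K i j)
    {f : ι → ℝ} (hf : ∑ i, μ i * f i = 0) (hB : ∀ i, |f i| ≤ B) :
    ∃ g : ι → ℝ, (∀ i, |g i| ≤ B / q) ∧ ∀ i, g i = f i + ∑ j, K i j * g j := by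
  classical
  -- Removing the rank-one part qμ leaves a nonnegative matrix with row sums 1 − q. A maximum
  -- principle then bounds the inverse of T by 1/q, and injectivity gives solvability.
  let T : (ι → ℝ) →ₗ[ℝ] (ι → ℝ) := LinearMap.id - Matrix.toLin' (Matrix.of fun i j => K i j - q * μ j)
  have hT : ∀ g i, T g i = g i - ∑ j, (K i j - q * μ j) * g j := fun g i => by
    simp [T, Matrix.mulVec, dotProduct]
  have hbound : ∀ (g : ι → ℝ) (C : ℝ), (∀ i, |T g i| ≤ C) → ∀ i, |g i| ≤ C / q := by
    intro g C hC
    obtain ⟨i₀, hi₀⟩ := Finite.exists_max fun i => |g i|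
    have h1 : |∑ j, (K i₀ j - q * μ j) * g j| ≤ (1 - q) * |g i₀| := by
      calc |∑ j, (K i₀ j - q * μ j) * g j|
          ≤ ∑ j, |(K i₀ j - q * μ j) * g j| := Finset.abs_sum_le_sum_abs _ _
        _ ≤ ∑ j, (K i₀ j - q * μ j) * |g i₀| := by
            refine Finset.sum_le_sum fun j _ => ?_
            rw [abs_mul, abs_of_nonneg (sub_nonneg.2 (hdom i₀ j))]
            exact mul_le_mul_of_nonneg_left (hi₀ j) (sub_nonneg.2 (hdom i₀ j))
        _ = (1 - q) * |g i₀| := by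
            rw [← Finset.sum_mul, Finset.sum_sub_distrib, hK1, ← Finset.mul_sum, hμ1, mul_one]
    have h2 : |g i₀| ≤ C + (1 - q) * |g i₀| := by
      have h3 : g i₀ = T g i₀ + ∑ j, (K i₀ j - q * μ j) * g j := by rw [hT]; ring
      calc |g i₀| ≤ |T g i₀| + |∑ j, (K i₀ j - q * μ j) * g j| := by
            conv_lhs => rw [h3]
            exact abs_add_le _ _
        _ ≤ _ := add_le_add (hC i₀) h1
    intro i
    refine (hi₀ i).trans ?_
    rw [le_div_iff₀ hq]
    linarith
  have hinj : Function.Injective T := by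
    rw [← LinearMap.ker_eq_bot, LinearMap.ker_eq_bot']
    intro g hg
    funext i
    have := hbound g 0 (fun i => by simp [hg]) i
    simpa using this
  obtain ⟨g, hg⟩ := (LinearMap.injective_iff_surjective.1 hinj) f
  refine ⟨g, hbound g B fun i => by rw [hg]; exact hB i, fun i => ?_⟩
  have hTg : ∀ i, g i - ∑ j, K i j * g j + q * ∑ j, μ j * g j = f i := by
    intro i
    rw [← hg, hT]
    simp_rw [sub_mul, Finset.sum_sub_distrib, Finset.mul_sum, mul_assoc]
    ring
  -- Averaging T g = f against μ cancels g − Kg by stationarity and leaves q·μ(g) = 0, so the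
  -- rank-one term disappears.
  have hμg : ∑ j, μ j * g j = 0 := by
    have h1 : ∑ i, μ i * (g i - ∑ j, K i j * g j + q * ∑ j, μ j * g j) = 0 := by
      simp_rw [hTg]; exact hf
    have h2 : ∑ i, μ i * ∑ j, K i j * g j = ∑ j, μ j * g j := by
      simp_rw [Finset.mul_sum]
      rw [Finset.sum_comm]
      refine Finset.sum_congr rfl fun j _ => ?_
      simp_rw [← mul_assoc]
      rw [← Finset.sum_mul, hμK]
    simp_rw [mul_add, mul_sub, Finset.sum_add_distrib, Finset.sum_sub_distrib] at h1
    rw [h2, sub_self, zero_add, ← Finset.sum_mul, hμ1, one_mul] at h1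
    exact (mul_eq_zero.1 h1).resolve_left hq.ne'
  have := hTg i
  rw [hμg, mul_zero, add_zero] at this
  linarith

lemma exp_le_one_add_add_sq (y : ℝ) : Real.exp y ≤ 1 + y + y ^ 2 * Real.exp |y| := by
  have h1 : ∀ z : ℝ, Real.exp z - 1 ≤ z * Real.exp z := by
    intro z
    have h : 1 - z ≤ Real.exp (-z) := by linarith [Real.add_one_le_exp (-z)]
    have h' := mul_le_mul_of_nonneg_right h (Real.exp_pos z).le
    rw [← Real.exp_add, neg_add_cancel, Real.exp_zero] at h'
    linarith
  have h2 : Real.exp y ≤ 1 + y + y * (Real.exp y - 1) := by linarith [h1 y]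
  refine h2.trans ?_
  rcases le_total 0 y with hy | hy
  · rw [abs_of_nonneg hy]
    nlinarith [mul_le_mul_of_nonneg_left (h1 y) hy]
  · have h3 : 1 ≤ Real.exp |y| := Real.one_le_exp (abs_nonneg y)
    nlinarith [Real.add_one_le_exp y, sq_nonneg y]

/-! ### Stopping times and stopped positions as integrable random variables. -/

lemma IsStop.measurable_time {τ : (ℕ → Torus n) → ℕ∞} (hτ : IsStop τ) (x : Torus n) :
    Measurable fun ω => τ (walk x ω) := by
  have hk : ∀ k : ℕ, MeasurableSet {ω | τ (walk x ω) = (k : ℕ∞)} := fun k =>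
    measurableSet_setOfPred.2 ((hτ k).measurable x)
  refine measurable_to_countable' fun t => ?_
  rcases eq_or_ne t ⊤ with rfl | ht
  · have : (fun ω => τ (walk x ω)) ⁻¹' {⊤} = (⋃ k : ℕ, {ω | τ (walk x ω) = (k : ℕ∞)})ᶜ := by
      ext ω
      simp only [Set.mem_preimage, Set.mem_singleton_iff, Set.mem_compl_iff, Set.mem_iUnion,
        Set.mem_ofPred_eq, not_exists]
      constructor
      · intro h k
        rw [h]
        exact ENat.top_ne_natCast k
      · intro h
        by_contra h'
        obtain ⟨k, hk⟩ := ENat.ne_top_iff_exists.1 h'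
        exact h k hk.symm
    rw [this]
    exact (MeasurableSet.iUnion hk).compl
  · obtain ⟨k, rfl⟩ := ENat.ne_top_iff_exists.1 ht
    exact hk k

/-- The position `S_τ` (`S_0` on `τ = ∞`). -/
def stoppedPos (τ : (ℕ → Torus n) → ℕ∞) (x : Torus n) (ω : ℕ → Fin 4) : Torus n :=
  walk x ω (τ (walk x ω)).toNat

/-- The time `τ` as a real number (`0` on `τ = ∞`). -/
def stoppedTime (τ : (ℕ → Torus n) → ℕ∞) (x : Torus n) (ω : ℕ → Fin 4) : ℝ :=
  (τ (walk x ω)).toNat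

lemma IsStop.measurable_toNat {τ : (ℕ → Torus n) → ℕ∞} (hτ : IsStop τ) (x : Torus n) :
    Measurable fun ω => (τ (walk x ω)).toNat :=
  Measurable.of_discrete.comp (hτ.measurable_time x)

lemma IsStop.measurable_stoppedTime {τ : (ℕ → Torus n) → ℕ∞} (hτ : IsStop τ) (x : Torus n) :
    Measurable (stoppedTime τ x) :=
  (Measurable.of_discrete (f := fun k : ℕ => (k : ℝ))).comp (hτ.measurable_toNat x)

lemma IsStop.measurable_stoppedPos {τ : (ℕ → Torus n) → ℕ∞} (hτ : IsStop τ) (x : Torus n) :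
    Measurable (stoppedPos τ x) := by
  have h : Measurable fun p : ℕ × (ℕ → Fin 4) => walk x p.2 p.1 :=
    measurable_from_prod_countable_right fun k =>
      DependsUpTo.measurable (k := k) (Φ := fun s => s k) (fun s s' h => h k le_rfl) x
  exact h.comp ((hτ.measurable_toNat x).prodMk measurable_id)

lemma stoppedExp_eq_lintegral {τ : (ℕ → Torus n) → ℕ∞} {x : Torus n}
    (h : ∀ᵐ ω ∂stepLaw, τ (walk x ω) ≠ ⊤) (F : ℕ → Torus n → ℝ≥0∞) :
    stoppedExp x τ F = ∫⁻ ω, F (τ (walk x ω)).toNat (stoppedPos τ x ω) ∂stepLaw := by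
  refine lintegral_congr_ae ?_
  filter_upwards [h] with ω hω
  obtain ⟨k, hk⟩ := ENat.ne_top_iff_exists.1 hω
  rw [stopped_of_eq hk.symm]
  simp [stoppedPos, ← hk]

lemma HasExpBound.lintegral_exp {τ : (ℕ → Torus n) → ℕ∞} {Λ C : ℝ} (h : HasExpBound τ Λ C)
    (x : Torus n) :
    ∫⁻ ω, ENNReal.ofReal (Real.exp (stoppedTime τ x ω / (2 * Λ))) ∂stepLaw ≤ ENNReal.ofReal C := by
  have := h.exp_le x
  rwa [stoppedExp_eq_lintegral (h.ae_ne_top x)] at this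

lemma HasExpBound.integrable_exp {τ : (ℕ → Torus n) → ℕ∞} {Λ C : ℝ} (h : HasExpBound τ Λ C)
    (hτ : IsStop τ) (x : Torus n) :
    Integrable (fun ω => Real.exp (stoppedTime τ x ω / (2 * Λ))) stepLaw := by
  refine ⟨(Real.measurable_exp.comp
    ((hτ.measurable_stoppedTime x).div_const _)).aestronglyMeasurable, ?_⟩
  rw [hasFiniteIntegral_iff_ofReal (Filter.Eventually.of_forall fun _ => (Real.exp_pos _).le)]
  exact (h.lintegral_exp x).trans_lt ENNReal.ofReal_lt_top

lemma HasExpBound.integral_exp_le {τ : (ℕ → Torus n) → ℕ∞} {Λ C : ℝ} (h : HasExpBound τ Λ C)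
    (hC : 0 ≤ C) (hτ : IsStop τ) (x : Torus n) :
    ∫ ω, Real.exp (stoppedTime τ x ω / (2 * Λ)) ∂stepLaw ≤ C := by
  have h1 := ofReal_integral_eq_lintegral_ofReal (h.integrable_exp hτ x)
    (Filter.Eventually.of_forall fun _ => (Real.exp_pos _).le)
  rw [← ENNReal.ofReal_le_ofReal_iff hC, h1]
  exact h.lintegral_exp x

lemma stoppedTime_nonneg (τ : (ℕ → Torus n) → ℕ∞) (x : Torus n) (ω : ℕ → Fin 4) :
    0 ≤ stoppedTime τ x ω := Nat.cast_nonneg _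

lemma HasExpBound.integrable_stoppedTime {τ : (ℕ → Torus n) → ℕ∞} {Λ C : ℝ}
    (h : HasExpBound τ Λ C) (hΛ : 0 < Λ) (hτ : IsStop τ) (x : Torus n) :
    Integrable (stoppedTime τ x) stepLaw := by
  refine ((h.integrable_exp hτ x).const_mul (2 * Λ)).mono'
    (hτ.measurable_stoppedTime x).aestronglyMeasurable (Filter.Eventually.of_forall fun ω => ?_)
  rw [Real.norm_of_nonneg (stoppedTime_nonneg _ _ _)]
  have h1 := Real.add_one_le_exp (stoppedTime τ x ω / (2 * Λ))
  have h2 : stoppedTime τ x ω = 2 * Λ * (stoppedTime τ x ω / (2 * Λ)) := by field_simp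
  have : stoppedTime τ x ω / (2 * Λ) ≤ Real.exp (stoppedTime τ x ω / (2 * Λ)) := by linarith
  calc stoppedTime τ x ω = 2 * Λ * (stoppedTime τ x ω / (2 * Λ)) := h2
    _ ≤ _ := mul_le_mul_of_nonneg_left this (by positivity)

lemma HasExpBound.integral_stoppedTime_le {τ : (ℕ → Torus n) → ℕ∞} {Λ C : ℝ}
    (h : HasExpBound τ Λ C) (hΛ : 0 < Λ) (hC : 0 ≤ C) (hτ : IsStop τ) (x : Torus n) :
    ∫ ω, stoppedTime τ x ω ∂stepLaw ≤ 2 * Λ * (C - 1) := by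
  have h1 : ∫ ω, stoppedTime τ x ω ∂stepLaw
      ≤ ∫ ω, 2 * Λ * (Real.exp (stoppedTime τ x ω / (2 * Λ)) - 1) ∂stepLaw := by
    refine integral_mono (h.integrable_stoppedTime hΛ hτ x)
      (((h.integrable_exp hτ x).sub (integrable_const 1)).const_mul _) fun ω => ?_
    have h1 := Real.add_one_le_exp (stoppedTime τ x ω / (2 * Λ))
    have h2 : stoppedTime τ x ω = 2 * Λ * (stoppedTime τ x ω / (2 * Λ)) := by field_simp
    calc stoppedTime τ x ω = 2 * Λ * (stoppedTime τ x ω / (2 * Λ)) := h2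
      _ ≤ _ := mul_le_mul_of_nonneg_left (by linarith) (by positivity)
  refine h1.trans ?_
  rw [integral_const_mul, integral_sub (h.integrable_exp hτ x) (integrable_const 1)]
  simp only [integral_const, probReal_univ, smul_eq_mul, mul_one]
  exact mul_le_mul_of_nonneg_left (sub_le_sub_right (h.integral_exp_le hC hτ x) 1) (by positivity)

lemma integrable_comp_stoppedPos [NeZero n] {τ : (ℕ → Torus n) → ℕ∞}
    (hτ : IsStop τ) (x : Torus n) (g : Torus n → ℝ) :
    Integrable (fun ω => g (stoppedPos τ x ω)) stepLaw := by
  obtain ⟨C, hC⟩ : ∃ C, ∀ z, |g z| ≤ C := by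
    obtain ⟨z, hz⟩ := Finite.exists_max fun z => |g z|
    exact ⟨_, hz⟩
  exact Integrable.of_bound
    (Measurable.of_discrete.comp (hτ.measurable_stoppedPos x)).aestronglyMeasurable C
    (Filter.Eventually.of_forall fun ω => hC _)

lemma HasExpBound.integral_comp_stoppedPos [NeZero n] {τ : (ℕ → Torus n) → ℕ∞} {Λ C : ℝ}
    (h : HasExpBound τ Λ C) (hτ : IsStop τ) (x : Torus n) (g : Torus n → ℝ) :
    ∫ ω, g (stoppedPos τ x ω) ∂stepLaw = ∑ z, stopKernel τ x z * g z := by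
  classical
  have hset : ∀ z, MeasurableSet {ω | stoppedPos τ x ω = z} := fun z =>
    hτ.measurable_stoppedPos x (MeasurableSet.singleton z)
  have hK : ∀ z, stopKernel τ x z = stepLaw.real {ω | stoppedPos τ x ω = z} := by
    intro z
    rw [stopKernel, Measure.real, prob_stopped_at hτ, stoppedExp_eq_lintegral (h.ae_ne_top x),
      ← lintegral_indicator_one (hset z)]
    congr 1
    refine lintegral_congr fun ω => ?_
    simp [Set.indicator_apply]
  have hg : ∀ ω, g (stoppedPos τ x ω)
      = ∑ z, {ω | stoppedPos τ x ω = z}.indicator (fun _ => g z) ω := by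
    intro ω
    simp [Set.indicator_apply]
  simp_rw [hg]
  rw [integral_finsetSum _ fun z _ => (integrable_const (g z)).indicator (hset z)]
  refine Finset.sum_congr rfl fun z _ => ?_
  rw [integral_indicator_const _ (hset z), hK, smul_eq_mul]

/-! ### The exponential supermartingale. -/

/-- `(2Λ)⁻² (X - M)² exp (|λ| |X - M|)` is dominated by `exp (X / (2Λ))`. -/
lemma sq_mul_exp_le {X M Λ l : ℝ} (hΛ : 0 < Λ) (hX : 0 ≤ X) (hM0 : 0 ≤ M) (hM : M ≤ 6 * Λ)
    (hl : |l| * Λ ≤ 1 / 8) :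
    (X - M) ^ 2 * Real.exp |l * (X - M)| ≤ 640 * Λ ^ 2 * Real.exp (X / (2 * Λ)) := by
  set t := X / (2 * Λ) with ht
  have ht0 : 0 ≤ t := by positivity
  have hXt : X = 2 * Λ * t := by rw [ht]; field_simp
  have habs : |X - M| ≤ 2 * Λ * (t + 3) := by
    rw [abs_le]; constructor <;> nlinarith
  have h1 : (X - M) ^ 2 ≤ (2 * Λ * (t + 3)) ^ 2 := sq_le_sq' (abs_le.1 habs).1 (abs_le.1 habs).2
  have h2 : |l * (X - M)| ≤ (t + 3) / 4 := by
    rw [abs_mul]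
    calc |l| * |X - M| ≤ |l| * (2 * Λ * (t + 3)) := mul_le_mul_of_nonneg_left habs (abs_nonneg _)
      _ = 2 * (|l| * Λ) * (t + 3) := by ring
      _ ≤ 2 * (1 / 8) * (t + 3) := by
          apply mul_le_mul_of_nonneg_right _ (by linarith); linarith
      _ = (t + 3) / 4 := by ring
  have h3 : (t + 3) ^ 2 ≤ 32 * Real.exp ((t + 3) / 4) := by
    have := Real.quadratic_le_exp_of_nonneg (x := (t + 3) / 4) (by positivity)
    nlinarith
  have h4 : Real.exp ((t + 3) / 4) * Real.exp ((t + 3) / 4) ≤ 5 * Real.exp t := by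
    rw [← Real.exp_add]
    have h5 : Real.exp (3 / 2) ≤ 5 := by
      have h6 := Real.exp_one_lt_d9
      have h7 : Real.exp (3 / 2) ^ 2 = Real.exp 1 ^ 3 := by
        rw [← Real.exp_nat_mul, ← Real.exp_nat_mul]; norm_num
      have h8 : Real.exp 1 ^ 3 ≤ 2.72 ^ 3 := pow_le_pow_left₀ (Real.exp_pos _).le (by linarith) 3
      nlinarith [Real.exp_pos (3 / 2)]
    calc Real.exp ((t + 3) / 4 + (t + 3) / 4) ≤ Real.exp (3 / 2 + t) :=
          Real.exp_le_exp.2 (by linarith)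
      _ = Real.exp (3 / 2) * Real.exp t := Real.exp_add _ _
      _ ≤ _ := mul_le_mul_of_nonneg_right h5 (Real.exp_pos _).le
  calc (X - M) ^ 2 * Real.exp |l * (X - M)|
      ≤ (2 * Λ * (t + 3)) ^ 2 * Real.exp ((t + 3) / 4) :=
        mul_le_mul h1 (Real.exp_le_exp.2 h2) (Real.exp_pos _).le (sq_nonneg _)
    _ = 4 * Λ ^ 2 * ((t + 3) ^ 2 * Real.exp ((t + 3) / 4)) := by ring
    _ ≤ 4 * Λ ^ 2 * (32 * (5 * Real.exp t)) := by
        refine mul_le_mul_of_nonneg_left ?_ (by positivity)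
        calc (t + 3) ^ 2 * Real.exp ((t + 3) / 4)
            ≤ 32 * Real.exp ((t + 3) / 4) * Real.exp ((t + 3) / 4) :=
              mul_le_mul_of_nonneg_right h3 (Real.exp_pos _).le
          _ ≤ 32 * (5 * Real.exp t) := by rw [mul_assoc]; linarith
    _ = 640 * Λ ^ 2 * Real.exp t := by ring

/-- The terms linear in `l` are kept exactly, since Poisson's equation will cancel them in the mean;
everything quadratic goes into one integrable error. The constant 1000 covers 640·3/2 from the
exponential and 6 from the cross term. -/
lemma tilted_le {X M Λ l B g : ℝ} (hΛ : 0 < Λ) (hX : 0 ≤ X) (hM0 : 0 ≤ M) (hM : M ≤ 6 * Λ)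
    (hl : |l| * Λ ≤ 1 / 8) (hg : |g| ≤ B) (hB : Λ ≤ B) (hlB : |l| * B ≤ 1 / 2) :
    Real.exp (l * (X - M)) * (1 + l * g)
      ≤ 1 + l * (X - M) + l * g + 1000 * l ^ 2 * Λ * B * Real.exp (X / (2 * Λ)) := by
  have hlg : |l * g| ≤ 1 / 2 := by
    rw [abs_mul]
    exact (mul_le_mul_of_nonneg_left hg (abs_nonneg l)).trans hlB
  obtain ⟨hlg1, hlg2⟩ := abs_le.1 hlg
  have h1 := exp_le_one_add_add_sq (l * (X - M))
  have h2 := sq_mul_exp_le hΛ hX hM0 hM hl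
  have hB0 : 0 < B := hΛ.trans_le hB
  set E := Real.exp (X / (2 * Λ)) with hE
  have hE1 : 1 ≤ E := Real.one_le_exp (by positivity)
  have h3 : (l * (X - M)) ^ 2 * Real.exp |l * (X - M)| ≤ l ^ 2 * (640 * Λ ^ 2 * E) := by
    rw [mul_pow, mul_assoc]
    exact mul_le_mul_of_nonneg_left h2 (sq_nonneg l)
  have h4 : Real.exp (l * (X - M)) * (1 + l * g)
      ≤ (1 + l * (X - M) + l ^ 2 * (640 * Λ ^ 2 * E)) * (1 + l * g) :=
    mul_le_mul_of_nonneg_right (by linarith) (by linarith)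
  have hXM : |X - M| ≤ 6 * Λ * E := by
    have h5 := Real.add_one_le_exp (X / (2 * Λ))
    have hXt : X = 2 * Λ * (X / (2 * Λ)) := by field_simp
    have h6 : X ≤ 2 * Λ * E := by
      rw [hXt]
      exact mul_le_mul_of_nonneg_left (by linarith) (by positivity)
    rw [abs_le]
    constructor <;> nlinarith
  have h7 : (X - M) * g ≤ 6 * Λ * E * B := by
    calc (X - M) * g ≤ |X - M| * |g| := by rw [← abs_mul]; exact le_abs_self _
      _ ≤ 6 * Λ * E * B := mul_le_mul hXM hg (abs_nonneg _) (by positivity)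
  have h8 : l ^ 2 * ((X - M) * g) ≤ l ^ 2 * (6 * Λ * E * B) :=
    mul_le_mul_of_nonneg_left h7 (sq_nonneg l)
  have h9 : l ^ 2 * (640 * Λ ^ 2 * E) * (1 + l * g) ≤ l ^ 2 * (640 * (Λ * B) * E) * (3 / 2) := by
    apply mul_le_mul _ (by linarith) (by linarith) (by positivity)
    apply mul_le_mul_of_nonneg_left _ (sq_nonneg l)
    apply mul_le_mul_of_nonneg_right _ (by linarith)
    nlinarith
  have h10 : 0 ≤ l ^ 2 * (Λ * B * E) := by positivity
  calc Real.exp (l * (X - M)) * (1 + l * g) ≤ _ := h4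
    _ = 1 + l * (X - M) + l * g + l ^ 2 * ((X - M) * g)
        + l ^ 2 * (640 * Λ ^ 2 * E) * (1 + l * g) := by ring
    _ ≤ _ := by linarith

lemma stoppedExp_const_mul {τ : (ℕ → Torus n) → ℕ∞} (hτ : IsStop τ) (x : Torus n) (c : ℝ≥0∞)
    (F : ℕ → Torus n → ℝ≥0∞) :
    stoppedExp x τ (fun k z => c * F k z) = c * stoppedExp x τ F := by
  unfold stoppedExp
  rw [← lintegral_const_mul _ (hτ.measurable_stopped F x)]
  refine lintegral_congr fun ω => ?_
  rcases eq_or_ne (τ (walk x ω)) ⊤ with h | h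
  · simp [stopped_of_top h]
  · obtain ⟨k, hk⟩ := ENat.ne_top_iff_exists.1 h
    rw [stopped_of_eq hk.symm, stopped_of_eq hk.symm]

/-- One step of the exponential supermartingale built on a solution `g` of Poisson's equation. -/
lemma stoppedExp_tilted_le [NeZero n] {τ : (ℕ → Torus n) → ℕ∞} {Λ M l B : ℝ} {g : Torus n → ℝ}
    (h : HasExpBound τ Λ 4) (hτ : IsStop τ) (hΛ : 0 < Λ) (hM0 : 0 ≤ M) (hM : M ≤ 6 * Λ)
    (hl : |l| * Λ ≤ 1 / 8) (hg : ∀ z, |g z| ≤ B) (hB : Λ ≤ B) (hlB : |l| * B ≤ 1 / 2)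
    (hpoisson : ∀ x, g x = (∫ ω, stoppedTime τ x ω ∂stepLaw - M) + ∑ z, stopKernel τ x z * g z)
    (x : Torus n) :
    stoppedExp x τ (fun k z => ENNReal.ofReal (Real.exp (l * (k - M)) * (1 + l * g z)))
      ≤ ENNReal.ofReal ((1 + l * g x) * Real.exp (8000 * l ^ 2 * Λ * B)) := by
  have hlg : ∀ z, |l * g z| ≤ 1 / 2 := fun z => by
    rw [abs_mul]
    exact (mul_le_mul_of_nonneg_left (hg z) (abs_nonneg l)).trans hlB
  have hB0 : 0 < B := hΛ.trans_le hB
  have hX := h.integrable_stoppedTime hΛ hτ x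
  have hE := h.integrable_exp hτ x
  have hG := integrable_comp_stoppedPos hτ x g
  have hY1 : Integrable (fun ω => l * (stoppedTime τ x ω - M)) stepLaw :=
    (hX.sub (integrable_const M)).const_mul l
  have hY2 : Integrable (fun ω => 1 + l * (stoppedTime τ x ω - M)) stepLaw :=
    (integrable_const 1).add hY1
  have hY3 : Integrable (fun ω => 1 + l * (stoppedTime τ x ω - M) + l * g (stoppedPos τ x ω))
      stepLaw := hY2.add (hG.const_mul l)
  have hYint : Integrable (fun ω => 1 + l * (stoppedTime τ x ω - M) + l * g (stoppedPos τ x ω)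
      + 1000 * l ^ 2 * Λ * B * Real.exp (stoppedTime τ x ω / (2 * Λ))) stepLaw :=
    hY3.add (hE.const_mul _)
  have hpt : ∀ ω, Real.exp (l * (stoppedTime τ x ω - M)) * (1 + l * g (stoppedPos τ x ω))
      ≤ 1 + l * (stoppedTime τ x ω - M) + l * g (stoppedPos τ x ω)
      + 1000 * l ^ 2 * Λ * B * Real.exp (stoppedTime τ x ω / (2 * Λ)) := fun ω =>
    tilted_le hΛ (stoppedTime_nonneg _ _ _) hM0 hM hl (hg _) hB hlB
  have hpos : ∀ ω, 0 ≤ Real.exp (l * (stoppedTime τ x ω - M)) * (1 + l * g (stoppedPos τ x ω)) :=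
    fun ω => mul_nonneg (Real.exp_pos _).le (by linarith [(abs_le.1 (hlg (stoppedPos τ x ω))).1])
  rw [stoppedExp_eq_lintegral (h.ae_ne_top x)]
  refine (lintegral_mono fun ω => ENNReal.ofReal_le_ofReal (hpt ω)).trans ?_
  rw [← ofReal_integral_eq_lintegral_ofReal hYint
    (Filter.Eventually.of_forall fun ω => (hpos ω).trans (hpt ω))]
  apply ENNReal.ofReal_le_ofReal
  have hint : ∫ ω, (1 + l * (stoppedTime τ x ω - M) + l * g (stoppedPos τ x ω)
      + 1000 * l ^ 2 * Λ * B * Real.exp (stoppedTime τ x ω / (2 * Λ))) ∂stepLaw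
      = 1 + l * (∫ ω, stoppedTime τ x ω ∂stepLaw - M) + l * ∑ z, stopKernel τ x z * g z
        + 1000 * l ^ 2 * Λ * B * ∫ ω, Real.exp (stoppedTime τ x ω / (2 * Λ)) ∂stepLaw := by
    rw [integral_add hY3 (hE.const_mul _), integral_add hY2 (hG.const_mul l),
      integral_add (integrable_const 1) hY1, integral_const_mul, integral_const_mul,
      integral_const_mul, integral_sub hX (integrable_const M), h.integral_comp_stoppedPos hτ]
    simp
  rw [hint]
  have hexp := h.integral_exp_le (by norm_num) hτ x
  have hc : 0 ≤ l ^ 2 * Λ * B := by positivity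
  have hlin : 1 + l * (∫ ω, stoppedTime τ x ω ∂stepLaw - M) + l * ∑ z, stopKernel τ x z * g z
      = 1 + l * g x := by rw [hpoisson x]; ring
  rw [hlin]
  have hlow := (abs_le.1 (hlg x)).1
  -- The exponential moment is at most 4, and 1 + l g ≥ 1/2 doubles the resulting 4000 when the
  -- error is written as a factor.
  calc 1 + l * g x + 1000 * l ^ 2 * Λ * B * ∫ ω, Real.exp (stoppedTime τ x ω / (2 * Λ)) ∂stepLaw
      ≤ 1 + l * g x + 4000 * (l ^ 2 * Λ * B) := by nlinarith
    _ ≤ (1 + l * g x) * (8000 * l ^ 2 * Λ * B + 1) := by nlinarith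
    _ ≤ _ := mul_le_mul_of_nonneg_left (Real.add_one_le_exp _) (by linarith)

/-- Iteration of the exponential estimate over the excursions. -/
lemma stoppedExp_excEnd_le [NeZero n] {y : Torus n} {R r : ℝ}
    (hd : Disjoint (circle y r) (circle y R)) {M l C D : ℝ} {g : Torus n → ℝ} (hC : 0 ≤ C)
    (hstep : ∀ x, stoppedExp x (cycleTime y R r)
      (fun k z => ENNReal.ofReal (Real.exp (l * (k - M)) * (1 + l * g z)))
      ≤ ENNReal.ofReal ((1 + l * g x) * C))
    (hstart : ∀ x, stoppedExp x (cycleTime y R r)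
      (fun k z => ENNReal.ofReal (Real.exp (l * k) * (1 + l * g z))) ≤ ENNReal.ofReal D)
    (m : ℕ) (x : Torus n) :
    stoppedExp x (excEnd y R r (m + 1))
      (fun k z => ENNReal.ofReal (Real.exp (l * (k - m * M)) * (1 + l * g z)))
      ≤ ENNReal.ofReal (C ^ m * D) := by
  induction m with
  | zero =>
    rw [zero_add, excEnd_one hd]
    -- The first cycle starts from an arbitrary point and is not centred, so m + 1 cycles are
    -- compared with m·M.
    simpa using hstart x
  | succ m ih =>
    rw [excEnd_succ hd, stoppedExp_seqTime (isStop_excEnd hd m) (isStop_cycleTime _ _ _)]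
    have hinner : ∀ (k : ℕ) (z : Torus n), stoppedExp z (cycleTime y R r)
        (fun (i : ℕ) w => ENNReal.ofReal (Real.exp (l * (((k + i : ℕ) : ℝ) - ((m + 1 : ℕ) : ℝ) * M))
          * (1 + l * g w)))
        ≤ ENNReal.ofReal C *
          ENNReal.ofReal (Real.exp (l * (k - m * M)) * (1 + l * g z)) := by
      intro k z
      have he : ∀ (i : ℕ) (w : Torus n), ENNReal.ofReal
          (Real.exp (l * (((k + i : ℕ) : ℝ) - ((m + 1 : ℕ) : ℝ) * M)) * (1 + l * g w))
          = ENNReal.ofReal (Real.exp (l * (k - m * M))) *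
            ENNReal.ofReal (Real.exp (l * (i - M)) * (1 + l * g w)) := by
        intro i w
        rw [← ENNReal.ofReal_mul (Real.exp_pos _).le, ← mul_assoc, ← Real.exp_add]
        congr 3
        push_cast
        ring
      simp_rw [he]
      rw [stoppedExp_const_mul (isStop_cycleTime _ _ _)]
      refine (mul_le_mul_right (hstep z) _).trans (le_of_eq ?_)
      rw [← ENNReal.ofReal_mul (Real.exp_pos _).le, ← ENNReal.ofReal_mul hC]
      congr 1
      ring
    refine (stoppedExp_mono hinner).trans ?_
    rw [stoppedExp_const_mul (isStop_excEnd hd m)]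
    refine (mul_le_mul_right ih _).trans (le_of_eq ?_)
    rw [← ENNReal.ofReal_mul hC]
    congr 1
    ring

/-! ### Excursion pairs, the constant q and the mean cycle length. -/

lemma PMF_sum_toReal {ι : Type*} [Fintype ι] (μ : PMF ι) : ∑ i, (μ i).toReal = 1 := by
  have h := μ.tsum_coe
  rw [tsum_fintype] at h
  rw [← ENNReal.toReal_sum fun i _ => μ.apply_ne_top i, h, ENNReal.toReal_one]

lemma probFrom_hitAt [NeZero n] (μ : PMF (Torus n)) (A : Set (Torus n)) (z : Torus n) :
    probFrom μ (hitAt A z) = ENNReal.ofReal (∑ x, (μ x).toReal * stopKernel (hit A) x z) := by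
  rw [ENNReal.ofReal_sum_of_nonneg fun x _ =>
    mul_nonneg ENNReal.toReal_nonneg (stopKernel_nonneg _ _ _)]
  refine Finset.sum_congr rfl fun x _ => ?_
  rw [ENNReal.ofReal_mul ENNReal.toReal_nonneg, ENNReal.ofReal_toReal (μ.apply_ne_top x),
    ofReal_stopKernel]
  rfl

/-- The parameters for which the excursions between the two circles are controlled, together with
the bounds on the two hitting times. -/
structure ExcursionSetup [NeZero n] (y : Torus n) (R r Λ : ℝ) : Prop where
  two_lt : 2 < n
  one_lt : 1 < r
  add_one_le : r + 1 ≤ R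
  scale_pos : 0 < Λ
  inner : HasExpBound (hit (circle y r)) Λ 2
  outer : HasExpBound (hit (circle y R)) Λ 2

namespace ExcursionSetup

variable [NeZero n] {y : Torus n} {R r Λ : ℝ}

lemma disjoint (S : ExcursionSetup y R r Λ) : Disjoint (circle y r) (circle y R) :=
  disjoint_circle S.two_lt S.one_lt S.add_one_le

lemma cycle (S : ExcursionSetup y R r Λ) : HasExpBound (cycleTime y R r) Λ 4 := by
  have h := S.inner.seqTime (isStop_hit _) (isStop_hit _) (by norm_num) S.outer
  norm_num at h
  exact h

lemma nonempty_inner (S : ExcursionSetup y R r Λ) : (circle y r).Nonempty := by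
  by_contra h
  rw [Set.not_nonempty_iff_eq_empty] at h
  have h1 := S.inner.sum_stopKernel (isStop_hit _) y
  rw [Finset.sum_eq_zero] at h1
  · exact zero_ne_one h1
  · intro z _
    exact stopKernel_hit_of_notMem _ (by rw [h]; exact Set.notMem_empty z)

lemma nonempty_outer (S : ExcursionSetup y R r Λ) : (circle y R).Nonempty := by
  by_contra h
  rw [Set.not_nonempty_iff_eq_empty] at h
  have h1 := S.outer.sum_stopKernel (isStop_hit _) y
  rw [Finset.sum_eq_zero] at h1
  · exact zero_ne_one h1
  · intro z _
    exact stopKernel_hit_of_notMem _ (by rw [h]; exact Set.notMem_empty z)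

/-- A stationary law of the cycle kernel serves as the outer measure; its image under the hitting
kernel of the inner circle serves as the inner one. -/
lemma exists_pair (S : ExcursionSetup y R r Λ) :
    ∃ μout μin : PMF (Torus n), IsExcursionPair y R r μout μin := by
  obtain ⟨ν, hν0, hν1, hν⟩ := exists_stationary (stopKernel (cycleTime y R r))
    (fun _ _ => stopKernel_nonneg _ _ _)
    (fun x => S.cycle.sum_stopKernel (isStop_cycleTime _ _ _) x)
  set κ : Torus n → ℝ := fun w => ∑ x, ν x * stopKernel (hit (circle y r)) x w with hκ
  have hκ0 : ∀ w, 0 ≤ κ w := fun w =>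
    Finset.sum_nonneg fun x _ => mul_nonneg (hν0 x) (stopKernel_nonneg _ _ _)
  have hκ1 : ∑ w, κ w = 1 := by
    rw [hκ, Finset.sum_comm]
    simp_rw [← Finset.mul_sum, S.inner.sum_stopKernel (isStop_hit _), mul_one, hν1]
  have hνκ : ∀ z, ∑ w, κ w * stopKernel (hit (circle y R)) w z = ν z := by
    intro z
    rw [← hν z]
    simp_rw [cycleTime, stopKernel_seqTime (isStop_hit (circle y r)) (isStop_hit (circle y R)), hκ,
      Finset.mul_sum, Finset.sum_mul]
    rw [Finset.sum_comm]
    simp_rw [mul_assoc]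
  let μout : PMF (Torus n) := PMF.ofFintype (fun z => ENNReal.ofReal (ν z)) (by
    rw [← ENNReal.ofReal_sum_of_nonneg fun z _ => hν0 z, hν1, ENNReal.ofReal_one])
  let μin : PMF (Torus n) := PMF.ofFintype (fun z => ENNReal.ofReal (κ z)) (by
    rw [← ENNReal.ofReal_sum_of_nonneg fun z _ => hκ0 z, hκ1, ENNReal.ofReal_one])
  have hout : ∀ z, μout z = ENNReal.ofReal (ν z) := fun z => PMF.ofFintype_apply _ z
  have hin : ∀ z, μin z = ENNReal.ofReal (κ z) := fun z => PMF.ofFintype_apply _ z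
  refine ⟨μout, μin, ⟨fun z hz => ?_, fun z hz => ?_, fun z _ => ?_, fun z _ => ?_⟩⟩
  · rw [hout, ← hνκ z]
    simp [stopKernel_hit_of_notMem _ hz]
  · rw [hin, hκ]
    simp [stopKernel_hit_of_notMem _ hz]
  · rw [hout, probFrom_hitAt]
    simp_rw [hin, ENNReal.toReal_ofReal (hκ0 _), hνκ]
  · rw [hin, probFrom_hitAt]
    simp_rw [hout, ENNReal.toReal_ofReal (hν0 _), hκ]

variable {μout μin : PMF (Torus n)}

lemma _root_.TorusWalk.IsExcursionPair.out_eq_sum (hp : IsExcursionPair y R r μout μin)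
    (z : Torus n) :
    (μout z).toReal = ∑ x, (μin x).toReal * stopKernel (hit (circle y R)) x z := by
  by_cases hz : z ∈ circle y R
  · rw [hp.out_eq z hz, probFrom_hitAt, ENNReal.toReal_ofReal]
    exact Finset.sum_nonneg fun x _ => mul_nonneg ENNReal.toReal_nonneg (stopKernel_nonneg _ _ _)
  · simp [hp.supp_out z hz, stopKernel_hit_of_notMem _ hz]

lemma _root_.TorusWalk.IsExcursionPair.in_eq_sum (hp : IsExcursionPair y R r μout μin)
    (z : Torus n) :
    (μin z).toReal = ∑ x, (μout x).toReal * stopKernel (hit (circle y r)) x z := by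
  by_cases hz : z ∈ circle y r
  · rw [hp.in_eq z hz, probFrom_hitAt, ENNReal.toReal_ofReal]
    exact Finset.sum_nonneg fun x _ => mul_nonneg ENNReal.toReal_nonneg (stopKernel_nonneg _ _ _)
  · simp [hp.supp_in z hz, stopKernel_hit_of_notMem _ hz]

/-- Eliminating μin from the two defining relations leaves the fixed-point equation for the composed
kernel. It holds for every pair, so uniqueness of the pair plays no role. -/
lemma _root_.TorusWalk.IsExcursionPair.stationary (hp : IsExcursionPair y R r μout μin)
    (z : Torus n) :
    ∑ x, (μout x).toReal * stopKernel (cycleTime y R r) x z = (μout z).toReal := by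
  rw [hp.out_eq_sum z]
  simp_rw [hp.in_eq_sum, cycleTime,
    stopKernel_seqTime (isStop_hit (circle y r)) (isStop_hit (circle y R)), Finset.mul_sum,
    Finset.sum_mul]
  rw [Finset.sum_comm]
  simp_rw [mul_assoc]

lemma hit_outer_pos (S : ExcursionSetup y R r Λ) {u v : Torus n} (hu : u ∈ circle y R)
    (hv : v ∈ circle y r) : 0 < stopKernel (hit (circle y R)) v u :=
  prob_hitAt_circle_pos S.two_lt (by linarith [S.one_lt, S.add_one_le]) hu
    ((dist2_lt_of_mem_circle S.two_lt S.one_lt hv).trans_le S.add_one_le)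

lemma out_pos (S : ExcursionSetup y R r Λ) (hp : IsExcursionPair y R r μout μin) {u : Torus n}
    (hu : u ∈ circle y R) : 0 < (μout u).toReal := by
  rw [hp.out_eq_sum]
  obtain ⟨x, hx⟩ := μin.support_nonempty
  rw [PMF.mem_support_iff] at hx
  have hxc : x ∈ circle y r := by
    by_contra h
    exact hx (hp.supp_in x h)
  exact Finset.sum_pos' (fun z _ => mul_nonneg ENNReal.toReal_nonneg (stopKernel_nonneg _ _ _))
    ⟨x, Finset.mem_univ x, mul_pos (ENNReal.toReal_pos hx (μin.apply_ne_top x))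
      (S.hit_outer_pos hu hxc)⟩

lemma excQ_pos (S : ExcursionSetup y R r Λ) (hp : IsExcursionPair y R r μout μin) :
    0 < excQ y R r μout := by
  -- A real infimum over an empty family would be 0; over this finite nonempty one it is attained.
  have : Nonempty (circle y R × circle y r) :=
    ⟨⟨⟨_, S.nonempty_outer.some_mem⟩, ⟨_, S.nonempty_inner.some_mem⟩⟩⟩
  obtain ⟨p, hpq⟩ := exists_eq_ciInf_of_finite (f := fun p : circle y R × circle y r =>
    (prob (p.2 : Torus n) (hitAt (circle y R) (p.1 : Torus n))).toReal
      / (μout (p.1 : Torus n)).toReal)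
  rw [excQ, ← hpq]
  exact div_pos (S.hit_outer_pos p.1.2 p.2.2) (S.out_pos hp p.1.2)

lemma excQ_mul_le (S : ExcursionSetup y R r Λ) (hp : IsExcursionPair y R r μout μin)
    {v : Torus n} (hv : v ∈ circle y r) (u : Torus n) :
    excQ y R r μout * (μout u).toReal ≤ stopKernel (hit (circle y R)) v u := by
  by_cases hu : u ∈ circle y R
  · rw [← le_div_iff₀ (S.out_pos hp hu)]
    exact ciInf_le (Set.finite_range _).bddBelow
      ((⟨u, hu⟩, ⟨v, hv⟩) : circle y R × circle y r)
  · simp [hp.supp_out u hu, stopKernel_nonneg]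

lemma excQ_le_one (S : ExcursionSetup y R r Λ) (hp : IsExcursionPair y R r μout μin) :
    excQ y R r μout ≤ 1 := by
  have h := Finset.sum_le_sum fun u (_ : u ∈ Finset.univ) =>
    S.excQ_mul_le hp S.nonempty_inner.some_mem u
  rwa [← Finset.mul_sum, PMF_sum_toReal, mul_one, S.outer.sum_stopKernel (isStop_hit _)] at h

/-- Doeblin's condition: every cycle passes through the inner circle, and from each of its points
the exit law dominates q μout. The start may therefore be any point of the torus. -/
lemma excQ_mul_le_cycle (S : ExcursionSetup y R r Λ) (hp : IsExcursionPair y R r μout μin)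
    (x u : Torus n) :
    excQ y R r μout * (μout u).toReal ≤ stopKernel (cycleTime y R r) x u := by
  rw [cycleTime, stopKernel_seqTime (isStop_hit _) (isStop_hit _)]
  calc excQ y R r μout * (μout u).toReal
      = ∑ w, stopKernel (hit (circle y r)) x w * (excQ y R r μout * (μout u).toReal) := by
        rw [← Finset.sum_mul, S.inner.sum_stopKernel (isStop_hit _), one_mul]
    _ ≤ _ := by
        refine Finset.sum_le_sum fun w _ => ?_
        by_cases hw : w ∈ circle y r
        · exact mul_le_mul_of_nonneg_left (S.excQ_mul_le hp hw u) (stopKernel_nonneg _ _ _)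
        · simp [stopKernel_hit_of_notMem _ hw]

lemma excEnd_bound (S : ExcursionSetup y R r Λ) (m : ℕ) :
    HasExpBound (excEnd y R r (m + 1)) Λ (4 ^ (m + 1)) := by
  induction m with
  | zero => rw [excEnd_one S.disjoint]; simpa using S.cycle
  | succ m ih =>
    rw [excEnd_succ S.disjoint, pow_succ]
    exact ih.seqTime (isStop_excEnd S.disjoint m) (isStop_cycleTime _ _ _) (by positivity) S.cycle

/-- The mean length of a cycle. -/
lemma expectFrom_excEnd_one (S : ExcursionSetup y R r Λ) (μ : PMF (Torus n)) :
    expectFrom μ (excEnd y R r 1) = ENNReal.ofReal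
      (∑ x, (μ x).toReal * ∫ ω, stoppedTime (cycleTime y R r) x ω ∂stepLaw) := by
  have h0 : ∀ x, 0 ≤ ∫ ω, stoppedTime (cycleTime y R r) x ω ∂stepLaw := fun x =>
    integral_nonneg fun ω => stoppedTime_nonneg _ _ _
  rw [ENNReal.ofReal_sum_of_nonneg fun x _ => mul_nonneg ENNReal.toReal_nonneg (h0 x), expectFrom,
    excEnd_one S.disjoint]
  refine Finset.sum_congr rfl fun x _ => ?_
  rw [ENNReal.ofReal_mul ENNReal.toReal_nonneg, ENNReal.ofReal_toReal (μ.apply_ne_top x),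
    ofReal_integral_eq_lintegral_ofReal
      (S.cycle.integrable_stoppedTime S.scale_pos (isStop_cycleTime _ _ _) x)
      (Filter.Eventually.of_forall fun ω => stoppedTime_nonneg _ _ _)]
  congr 1
  refine lintegral_congr_ae ?_
  filter_upwards [S.cycle.ae_ne_top x] with ω hω
  obtain ⟨k, hk⟩ := ENat.ne_top_iff_exists.1 hω
  simp [stoppedTime, ← hk]

lemma expectFrom_hit_le (S : ExcursionSetup y R r Λ) (μ : PMF (Torus n)) :
    expectFrom μ (hit (circle y r)) ≤ expectFrom μ (excEnd y R r 1) := by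
  rw [excEnd_one S.disjoint]
  refine Finset.sum_le_sum fun x _ => mul_le_mul_right (lintegral_mono fun ω => ?_) _
  exact ENat.toENNReal_le.2 le_self_add

end ExcursionSetup

/-! ### The Chernoff bound. -/

/-- Chernoff's bound for the deviation of `D_{N+1}`. -/
lemma prob_deviation_le [NeZero n] {y x : Torus n} {R r M δ l E : ℝ} {N : ℕ} {g : Torus n → ℝ}
    (hTime : IsStop (excEnd y R r (N + 1)))
    (hae : ∀ᵐ ω ∂stepLaw, excEnd y R r (N + 1) (walk x ω) ≠ ⊤)
    (hM : 0 < M) (hN : 0 < N) (hl : 0 ≤ l) (hE : 0 ≤ E) (hg : ∀ z, |l * g z| ≤ 1 / 2)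
    (hup : stoppedExp x (excEnd y R r (N + 1))
      (fun k z => ENNReal.ofReal (Real.exp (l * (k - N * M)) * (1 + l * g z)))
      ≤ ENNReal.ofReal E)
    (hdown : stoppedExp x (excEnd y R r (N + 1))
      (fun k z => ENNReal.ofReal (Real.exp (-l * (k - N * M)) * (1 + -l * g z)))
      ≤ ENNReal.ofReal E) :
    (prob x (deviation y R r M (N + 1) δ)).toReal ≤ 4 * E * Real.exp (-(l * (δ * (M * N)))) := by
  set τ := excEnd y R r (N + 1) with hτ
  set F : ℕ → Torus n → ℝ≥0∞ :=
    fun k z => ENNReal.ofReal (Real.exp (l * (k - N * M)) * (1 + l * g z)) with hF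
  set F' : ℕ → Torus n → ℝ≥0∞ :=
    fun k z => ENNReal.ofReal (Real.exp (-l * (k - N * M)) * (1 + -l * g z)) with hF'
  -- On the deviation event one of the two tilted variables is at least `a`; the factor 1/2 pays for
  -- 1 ± l g ≥ 1/2. Markov's inequality for their sum then gives 2E/a.
  set a : ℝ := Real.exp (l * (δ * (M * N))) / 2 with ha
  have ha0 : 0 < a := by positivity
  have hMN : 0 < M * N := mul_pos hM (Nat.cast_pos.2 hN)
  have hlarge : ∀ t b : ℝ, l * (δ * (M * N)) ≤ t → |b| ≤ 1 / 2 → a ≤ Real.exp t * (1 + b) := by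
    intro t b ht hb
    rw [ha, div_eq_mul_inv]
    refine mul_le_mul (Real.exp_le_exp.2 ht) ?_ (by norm_num) (Real.exp_pos _).le
    linarith [(abs_le.1 hb).1]
  have hdev : ∀ (k : ℕ) (z : Torus n), δ ≤ |(k : ℝ) / (M * (((N + 1 : ℕ) : ℝ) - 1)) - 1| →
      ENNReal.ofReal a ≤ F k z + F' k z := by
    intro k z h
    have hcast : ((N + 1 : ℕ) : ℝ) - 1 = N := by push_cast; ring
    rw [hcast] at h
    have hk : (k : ℝ) / (M * N) - 1 = (k - N * M) / (M * N) := by field_simp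
    rw [hk, abs_div, abs_of_pos hMN, le_div_iff₀ hMN] at h
    rcases le_total 0 ((k : ℝ) - N * M) with hs | hs
    · rw [abs_of_nonneg hs] at h
      refine le_trans (ENNReal.ofReal_le_ofReal ?_) le_self_add
      exact hlarge _ _ (mul_le_mul_of_nonneg_left h hl) (hg z)
    · rw [abs_of_nonpos hs] at h
      refine le_trans (ENNReal.ofReal_le_ofReal ?_) le_add_self
      refine hlarge _ _ ?_ (by rw [neg_mul, abs_neg]; exact hg z)
      rw [neg_mul, ← mul_neg]
      exact mul_le_mul_of_nonneg_left h hl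
  have hsub : prob x (deviation y R r M (N + 1) δ)
      ≤ stepLaw {ω | ENNReal.ofReal a ≤ stopped τ F (walk x ω) + stopped τ F' (walk x ω)} := by
    refine measure_mono_ae ?_
    filter_upwards [hae] with ω hω hdω
    obtain ⟨k, hk⟩ := ENat.ne_top_iff_exists.1 hω
    rcases hdω with h | h
    · exact absurd h hω
    · rw [← hτ, ← hk, ENat.toNat_natCast] at h
      change ENNReal.ofReal a ≤ _
      rw [stopped_of_eq hk.symm, stopped_of_eq hk.symm]
      exact hdev k _ h
  have hmark : prob x (deviation y R r M (N + 1) δ)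
      ≤ (ENNReal.ofReal E + ENNReal.ofReal E) / ENNReal.ofReal a := by
    refine hsub.trans ((meas_ge_le_lintegral_div
      ((hTime.measurable_stopped F x).add (hTime.measurable_stopped F' x)).aemeasurable
      (ENNReal.ofReal_pos.2 ha0).ne' ENNReal.ofReal_ne_top).trans ?_)
    refine ENNReal.div_le_div_right ?_ _
    refine le_trans (le_of_eq ?_) (add_le_add hup hdown)
    exact lintegral_add_left (hTime.measurable_stopped F x) _
  rw [← ENNReal.ofReal_add hE hE, ← ENNReal.ofReal_div_of_pos ha0] at hmark
  refine (ENNReal.toReal_le_of_le_ofReal (by positivity) hmark).trans (le_of_eq ?_)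
  rw [ha, Real.exp_neg]
  field_simp
  ring

/-- Poisson's equation for the mean cycle length feeds the exponential supermartingale with B =
6Λ/q; cycle means lie in [0, 6Λ] because 2Λ(4 − 1) = 6Λ. -/
lemma ExcursionSetup.prob_deviation_le [NeZero n] {y : Torus n} {R r Λ : ℝ}
    (S : ExcursionSetup y R r Λ) {μout μin : PMF (Torus n)}
    (hp : IsExcursionPair y R r μout μin) (x : Torus n) {N : ℕ} (hN : 0 < N) {δ : ℝ}
    (hδ0 : 0 ≤ δ) (hδ1 : δ ≤ 1) (hM : 0 < (expectFrom μout (excEnd y R r 1)).toReal) :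
    (prob x (deviation y R r (expectFrom μout (excEnd y R r 1)).toReal (N + 1) δ)).toReal
      ≤ 24 * Real.exp (-(excQ y R r μout * δ ^ 2
        * ((expectFrom μout (excEnd y R r 1)).toReal / Λ) ^ 2 * N / 192000)) := by
  set q := excQ y R r μout with hq
  have hq0 : 0 < q := S.excQ_pos hp
  have hq1 : q ≤ 1 := S.excQ_le_one hp
  set f : Torus n → ℝ := fun x => ∫ ω, stoppedTime (cycleTime y R r) x ω ∂stepLaw with hf
  have hf0 : ∀ x, 0 ≤ f x := fun x => integral_nonneg fun ω => stoppedTime_nonneg _ _ _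
  have hf6 : ∀ x, f x ≤ 6 * Λ := fun x => by
    have := S.cycle.integral_stoppedTime_le S.scale_pos (by norm_num) (isStop_cycleTime _ _ _) x
    simp only [hf]
    linarith
  set μ : Torus n → ℝ := fun x => (μout x).toReal with hμ
  have hμ0 : ∀ x, 0 ≤ μ x := fun x => ENNReal.toReal_nonneg
  have hμ1 : ∑ x, μ x = 1 := PMF_sum_toReal μout
  have hMeq : (expectFrom μout (excEnd y R r 1)).toReal = ∑ x, μ x * f x := by
    rw [S.expectFrom_excEnd_one, ENNReal.toReal_ofReal]
    exact Finset.sum_nonneg fun x _ => mul_nonneg (hμ0 x) (hf0 x)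
  set M := (expectFrom μout (excEnd y R r 1)).toReal with hMdef
  have hM6 : M ≤ 6 * Λ := by
    rw [hMeq]
    calc ∑ x, μ x * f x ≤ ∑ x, μ x * (6 * Λ) :=
          Finset.sum_le_sum fun x _ => mul_le_mul_of_nonneg_left (hf6 x) (hμ0 x)
      _ = 6 * Λ := by rw [← Finset.sum_mul, hμ1, one_mul]
  have hΛ := S.scale_pos
  obtain ⟨g, hgB, hg⟩ := exists_poisson (K := stopKernel (cycleTime y R r)) (μ := μ) (q := q)
    (f := fun x => f x - M) (B := 6 * Λ)
    (fun x => S.cycle.sum_stopKernel (isStop_cycleTime _ _ _) x) hμ1 (hp.stationary) hq0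
    (S.excQ_mul_le_cycle hp)
    (by simp_rw [mul_sub, Finset.sum_sub_distrib, ← Finset.sum_mul, hμ1, one_mul, hMeq, sub_self])
    (fun x => abs_le.2 ⟨by linarith [hf0 x], by linarith [hf6 x]⟩)
  set B := 6 * Λ / q with hB
  have hΛB : Λ ≤ B := by
    rw [hB, le_div_iff₀ hq0]
    nlinarith
  -- The minimiser of the exponent per cycle, 8000 l²ΛB − lδM = 48000 l²Λ²/q − lδM, with minimum
  -- −qδ²(M/Λ)²/192000.
  set l : ℝ := q * δ * M / (96000 * Λ ^ 2) with hl
  have hl0 : 0 ≤ l := by positivity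
  have hqδ : q * δ * M ≤ 6 * Λ := by
    have h1 : q * δ ≤ 1 := mul_le_one₀ hq1 hδ0 hδ1
    nlinarith
  have hlΛ : l * Λ ≤ 1 / 8 := by
    have : l * Λ = q * δ * M / (96000 * Λ) := by rw [hl]; field_simp
    rw [this, div_le_iff₀ (by positivity)]
    linarith
  have hlB : l * B ≤ 1 / 2 := by
    have h1 : l * B = 6 * (δ * M) / (96000 * Λ) := by rw [hl, hB]; field_simp
    have h2 : δ * M ≤ 6 * Λ := by nlinarith
    rw [h1, div_le_iff₀ (by positivity)]
    linarith
  have hlg : ∀ z, |l * g z| ≤ 1 / 2 := fun z => by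
    rw [abs_mul, abs_of_nonneg hl0]
    exact (mul_le_mul_of_nonneg_left (hgB z) hl0).trans hlB
  have hmain : ∀ l' : ℝ, |l'| = l → stoppedExp x (excEnd y R r (N + 1))
      (fun k z => ENNReal.ofReal (Real.exp (l' * (k - N * M)) * (1 + l' * g z)))
      ≤ ENNReal.ofReal (Real.exp (8000 * l ^ 2 * Λ * B) ^ N * 6) := by
    intro l' hl'
    have hl2 : l' ^ 2 = l ^ 2 := by rw [← hl', sq_abs]
    have hlg' : ∀ z, |l' * g z| ≤ 1 / 2 := fun z => by
      rw [abs_mul, hl', ← abs_of_nonneg hl0, ← abs_mul]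
      exact hlg z
    refine stoppedExp_excEnd_le S.disjoint (Real.exp_pos _).le (fun z => ?_) (fun z => ?_) N x
    · rw [← hl2]
      exact stoppedExp_tilted_le S.cycle (isStop_cycleTime _ _ _) hΛ hM.le hM6 (by rw [hl']; exact hlΛ)
        hgB hΛB (by rw [hl']; exact hlB) hg z
    -- The initial cycle costs the constant 6 = (3/2)·4: the bound on 1 + l' g times the exponential
    -- moment of a cycle.
    · have hle : ∀ (k : ℕ) (w : Torus n), ENNReal.ofReal (Real.exp (l' * k) * (1 + l' * g w))
          ≤ ENNReal.ofReal (3 / 2) * ENNReal.ofReal (Real.exp (k / (2 * Λ))) := by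
        intro k w
        rw [← ENNReal.ofReal_mul (by norm_num), mul_comm (3 / 2 : ℝ)]
        apply ENNReal.ofReal_le_ofReal
        have h1 := abs_le.1 (hlg' w)
        refine mul_le_mul (Real.exp_le_exp.2 ?_) (by linarith) (by linarith) (Real.exp_pos _).le
        have h2 : l' ≤ 1 / (2 * Λ) := by
          rw [le_div_iff₀ (by positivity)]
          have := le_abs_self l'
          rw [hl'] at this
          nlinarith
        calc l' * k ≤ 1 / (2 * Λ) * k := mul_le_mul_of_nonneg_right h2 (Nat.cast_nonneg k)
          _ = k / (2 * Λ) := by ring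
      refine (stoppedExp_mono hle).trans ?_
      rw [stoppedExp_const_mul (isStop_cycleTime _ _ _)]
      refine (mul_le_mul_right (S.cycle.exp_le z) _).trans (le_of_eq ?_)
      rw [← ENNReal.ofReal_mul (by norm_num)]
      norm_num
  refine (TorusWalk.prob_deviation_le (isStop_excEnd S.disjoint N)
    ((S.excEnd_bound N).ae_ne_top x) hM hN hl0 (by positivity) hlg
    (hmain l (abs_of_nonneg hl0)) (hmain (-l) (by rw [abs_neg, abs_of_nonneg hl0]))).trans
    (le_of_eq ?_)
  rw [← Real.exp_nat_mul, show ∀ a b : ℝ, 4 * (a * 6) * b = 24 * (a * b) by intro a b; ring,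
    ← Real.exp_add]
  congr 2
  rw [hB, hl]
  field_simp
  ring

end

end TorusWalk

/-! ### The theorem. -/

open TorusWalk in
theorem propositionA1 :
    ∃ c₁ c₂ c₃ c₄ c₅ c₆ c₇ c₈ : ℝ,
      (0 < c₁ ∧ 0 < c₂ ∧ 0 < c₃ ∧ 0 < c₄ ∧ 0 < c₅ ∧ 0 < c₆ ∧ 0 < c₇ ∧ 0 < c₈) ∧
      ∀ (n : ℕ) [NeZero n] (y : Torus n) (R r : ℝ),
        c₁ ≤ r → r < R / 4 → R / 4 < (n : ℝ) / 8 →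
        (∃ μout μin : PMF (Torus n), IsExcursionPair y R r μout μin) ∧
        ∀ μout μin : PMF (Torus n), IsExcursionPair y R r μout μin →
          0 < excQ y R r μout ∧
          expectFrom μout (excEnd y R r 1) ≠ ⊤ ∧
          expectFrom μout (hit (circle y r)) ≠ ⊤ ∧
          ∀ (x : Torus n) (m : ℕ) (δ : ℝ),
            1 + 4 * (excQ y R r μout)⁻¹ ≤ (m : ℝ) →
            4 / (((m : ℝ) - 1) * excQ y R r μout) < δ → δ < 1 →
            (prob x (deviation y R r
                (expectFrom μout (excEnd y R r 1)).toReal m δ)).toReal ≤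
              c₂ * Real.exp (-(c₃ * δ *
                ((expectFrom μout (excEnd y R r 1)).toReal
                  / ((n : ℝ) ^ 2 * Real.log ((n : ℝ) / r))) * ((m : ℝ) - 1)))
              + c₄ * Real.exp (-(c₅ * δ ^ 2 * ((m : ℝ) - 1))
                  + c₆ * δ * (1 / R) * ((m : ℝ) - 1))
              + c₇ * Real.exp (-(c₈ * excQ y R r μout * δ ^ 2 *
                ((expectFrom μout (hit (circle y r))).toReal
                  / ((n : ℝ) ^ 2 * Real.log ((n : ℝ) / r))) ^ 2 * ((m : ℝ) - 1))) := by
  -- The radius 100 is the threshold of `hasExpBound_hit_circle`, and 480000000 = 192000·50² since Λ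
  -- = 50 n² log(n/r). The constants of the first two terms are arbitrary.
  refine ⟨100, 1, 1, 1, 1, 1, 24, 1 / 480000000, by norm_num, ?_⟩
  intro n _ y R r hr hrR hRn
  have hn : R < (n : ℝ) / 2 := by linarith
  have hn0 : (0 : ℝ) < n := by linarith
  set L : ℝ := (n : ℝ) ^ 2 * Real.log ((n : ℝ) / r) with hL
  have hlog := log_two_le_log_div (N := n) (ρ := R) (by linarith) hn
  have hlogle : Real.log (n / R) ≤ Real.log (n / r) := by
    apply Real.log_le_log (div_pos hn0 (by linarith))
    exact div_le_div_of_nonneg_left hn0.le (by linarith) (by linarith)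
  have hn2 : (0 : ℝ) < (n : ℝ) ^ 2 := by positivity
  have hL0 : 0 < L := mul_pos hn2 (by linarith)
  have S : ExcursionSetup y R r (50 * L) :=
    { two_lt := by
        have : (2 : ℝ) < n := by linarith
        exact_mod_cast this
      one_lt := by linarith
      add_one_le := by linarith
      scale_pos := by positivity
      inner := hasExpBound_hit_circle hr (by linarith)
      -- The outer circle has the smaller scale n² log(n/R), which is enlarged to the common one.
      outer := (hasExpBound_hit_circle (by linarith) hn).mono
        (mul_pos (by norm_num) (mul_pos hn2 (by linarith)))
        (mul_le_mul_of_nonneg_left (mul_le_mul_of_nonneg_left hlogle hn2.le) (by norm_num)) }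
  refine ⟨S.exists_pair, fun μout μin hp => ?_⟩
  have hq0 := S.excQ_pos hp
  have hMtop : expectFrom μout (excEnd y R r 1) ≠ ⊤ := by
    rw [S.expectFrom_excEnd_one]
    exact ENNReal.ofReal_ne_top
  have hhM := S.expectFrom_hit_le μout
  have hhtop := ne_top_of_le_ne_top hMtop hhM
  refine ⟨hq0, hMtop, hhtop, fun x m δ hm hδ hδ1 => ?_⟩
  have hh := ENNReal.toReal_mono hMtop hhM
  set q := excQ y R r μout with hq
  set M := (expectFrom μout (excEnd y R r 1)).toReal with hM
  set h := (expectFrom μout (hit (circle y r))).toReal with hh'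
  have hh0 : 0 ≤ h := ENNReal.toReal_nonneg
  have hqinv : 0 < q⁻¹ := inv_pos.2 hq0
  have hm1 : (0 : ℝ) < (m : ℝ) - 1 := by linarith
  have hδ0 : 0 ≤ δ := le_trans (by positivity) hδ.le
  have key : (prob x (deviation y R r M m δ)).toReal
      ≤ 24 * Real.exp (-(1 / 480000000 * q * δ ^ 2 * (h / L) ^ 2 * ((m : ℝ) - 1))) := by
    -- If the mean hitting time vanishes, the right side is 24 and the claim is trivial; otherwise
    -- it forces M > 0, as the Chernoff bound requires.
    rcases hh0.eq_or_lt with h0 | hpos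
    · rw [← h0]
      have : (prob x (deviation y R r M m δ)).toReal ≤ 1 :=
        ENNReal.toReal_le_of_le_ofReal zero_le_one (by simpa using prob_le_one _ _)
      simp
      linarith
    · obtain ⟨N, rfl⟩ : ∃ N, m = N + 1 := by
        refine ⟨m - 1, ?_⟩
        have : 1 < m := by
          have : (1 : ℝ) < m := by linarith
          exact_mod_cast this
        omega
      have hcast : ((N + 1 : ℕ) : ℝ) - 1 = N := by push_cast; ring
      rw [hcast] at hm1 ⊢
      have hNpos : 0 < N := by exact_mod_cast hm1
      refine (S.prob_deviation_le hp x hNpos hδ0 hδ1.le (hpos.trans_le hh)).trans ?_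
      refine mul_le_mul_of_nonneg_left (Real.exp_le_exp.2 (neg_le_neg ?_)) (by norm_num)
      rw [← hq, ← hM]
      have hsq : (h / L) ^ 2 ≤ (M / L) ^ 2 :=
        pow_le_pow_left₀ (div_nonneg hh0 hL0.le) (div_le_div_of_nonneg_right hh hL0.le) 2
      have he : q * δ ^ 2 * (M / (50 * L)) ^ 2 * N / 192000
          = 1 / 480000000 * q * δ ^ 2 * (M / L) ^ 2 * N := by
        field_simp
        ring
      rw [he]
      exact mul_le_mul_of_nonneg_right (mul_le_mul_of_nonneg_left hsq (by positivity))
        (Nat.cast_nonneg N)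
  refine key.trans ?_
  have h1 := (Real.exp_pos (-(1 * δ * (M / L) * ((m : ℝ) - 1)))).le
  have h2 := (Real.exp_pos (-(1 * δ ^ 2 * ((m : ℝ) - 1)) + 1 * δ * (1 / R) * ((m : ℝ) - 1))).le
  linarith
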